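/- Let $d\ge 2$. For $0<p<\infty$ and $x\in\mathbb R^d$ put $\|x\|_p=(\sum_i|x_i|^p)^{1/p}$, and $\|x\|_\infty=\max_i|x_i|$. For $\alpha>0$ the conjugate index is $\beta=\alpha/(\alpha-1)$ if $\alpha>1$ and $\beta=\infty$ if $0<\alpha\le 1$. A Borel probability measure $P$ on $\mathbb R^d$ is $\alpha$-symmetric if its characteristic function has the form $t\mapsto\varphi(\|t\|_\alpha)$ with a continuous function $\varphi$. The halfspace depth of $x\in\mathbb R^d$ with respect to a Borel probability measure $P$ is $\mathcal D(x;P)=\inf_{\|u\|_2=1}P(\{y:\langle y,u\rangle\le\langle x,u\rangle\})$, and the halfspace median $\mu^{hs}(P)$ is the barycenter (the mean of the uniform distribution) of the non-empty compact convex set of all points of maximal depth. **Theorem.** There are universal constants $C_1,C_2>0$, and for every $\kappa>0$ there is a constant $C>0$ depending only on $\kappa$, such that the following holds. Let $\varepsilon\in(0,1/3)$, $\alpha>0$, let $\beta$ be the conjugate index of $\alpha$, let $\delta\in(0,1/2)$, and let $\gamma>0$ satisfy $\varepsilon/(1-\varepsilon)<\gamma\kappa\le 1/2$. Let $d\ge2$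 and $n\ge1$ be integers with $$C_1\sqrt{\frac dn}+C_2\sqrt{\frac{\log(1/\delta)}n}<\gamma\kappa-\frac{\varepsilon}{1-\varepsilon}.$$ Let $P$ be any $\alpha$-symmetric Borel probability measure on $\mathbb R^d$ with $P(\{0\})=0$ whose first marginal distribution function $F(t)=P(\{x: x_1\le t\})$ satisfies $$\inf_{0<|t|<\gamma}\frac{|F(t)-F(0)|}{|t|}\ge\kappa ,$$ and let $Q$ be any Borel probability measure on $\mathbb R^d$. Let $X_1,\dots,X_n$ be independent random vectors with law $(1-\varepsilon)P+\varepsilon Q$, let $\widehat P_n=\frac1n\sum_{i=1}^n\delta_{X_i}$, and put $\widehat\mu_n^{hs}=\mu^{hs}(\widehat P_n)$ and $\mu^{hs}=\mu^{hs}(P)$. Then, with probability at least $1-2\delta$, $$\|\widehat\mu^{hs}_n-\mu^{hs}\|_\beta\le C\left(\varepsilon+\sqrt{\frac dn}+\sqrt{\frac{\log(1/\delta)}n}\right).$$ -/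

import Mathlib

open MeasureTheory ProbabilityTheory
open scoped ENNReal RealInnerProductSpace

noncomputable section

/-- The `p`-norm of a vector of `ℝ^d` for `p ∈ (0, ∞]`: `(∑ |x_i| ^ p) ^ (1 / p)` for finite `p`, and
`max |x_i|` for `p = ∞` (for `p < 1` the triangle inequality fails). -/
def pNorm {d : ℕ} (p : ℝ≥0∞) (x : EuclideanSpace ℝ (Fin d)) : ℝ :=
  ‖(WithLp.toLp p (WithLp.ofLp x) : PiLp p fun _ : Fin d => ℝ)‖

/-- The conjugate index of `α > 0`: `α / (α - 1)` if `α > 1`, and `∞` if `0 < α ≤ 1`. -/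
def conjIndex (α : ℝ) : ℝ≥0∞ :=
  open Classical in if 1 < α then ENNReal.ofReal (α / (α - 1)) else ∞

/-- `P` is `α`-symmetric: its characteristic function is a continuous function of the `α`-norm. -/
def IsAlphaSymmetric {d : ℕ} (α : ℝ) (P : Measure (EuclideanSpace ℝ (Fin d))) : Prop :=
  ∃ φ : ℝ → ℂ, Continuous φ ∧
    ∀ t : EuclideanSpace ℝ (Fin d), charFun P t = φ (pNorm (ENNReal.ofReal α) t)

/-- The distribution function of the `i`-th coordinate under `P`. -/
def marginalCDF {d : ℕ} (P : Measure (EuclideanSpace ℝ (Fin d))) (i : Fin d) (t : ℝ) : ℝ :=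
  P.real {x | x i ≤ t}

/-- The growth condition `inf_{0 < |t| < γ} |F(t) - F(0)| / |t| ≥ κ`. -/
def GrowthCondition (γ κ : ℝ) (F : ℝ → ℝ) : Prop :=
  ∀ t : ℝ, 0 < |t| → |t| < γ → κ ≤ |F t - F 0| / |t|

/-- The halfspace (Tukey) depth of `x` with respect to `P`: the infimum, over unit vectors `u`, of
`P(⟨X, u⟩ ≤ ⟨x, u⟩)`. -/
def halfspaceDepth {d : ℕ} (x : EuclideanSpace ℝ (Fin d))
    (P : Measure (EuclideanSpace ℝ (Fin d))) : ℝ :=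
  ⨅ u : Metric.sphere (0 : EuclideanSpace ℝ (Fin d)) 1,
    P.real {y | ⟪y, (u : EuclideanSpace ℝ (Fin d))⟫ ≤ ⟪x, (u : EuclideanSpace ℝ (Fin d))⟫}

/-- The halfspace median set: all points of maximal halfspace depth. -/
def medianSet {d : ℕ} (P : Measure (EuclideanSpace ℝ (Fin d))) :
    Set (EuclideanSpace ℝ (Fin d)) :=
  {x | ∀ y, halfspaceDepth y P ≤ halfspaceDepth x P}

/-- The barycenter of a non-empty compact convex set `S`: the mean of the uniform distribution on `S`,
that is, of the normalized `k`-dimensional Hausdorff measure on `S`, where `k` is the dimension of the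
affine hull of `S` (so sets with empty interior are covered; for one point this is that point). -/
def barycenter {d : ℕ} (S : Set (EuclideanSpace ℝ (Fin d))) : EuclideanSpace ℝ (Fin d) :=
  ⨍ x in S, x ∂(Measure.hausdorffMeasure (Module.finrank ℝ (vectorSpan ℝ S) : ℝ))

/-- The halfspace median: the barycenter of the halfspace median set. -/
def halfspaceMedian {d : ℕ} (P : Measure (EuclideanSpace ℝ (Fin d))) :
    EuclideanSpace ℝ (Fin d) :=
  barycenter (medianSet P)

/-- The contaminated law `(1 - ε) P + ε Q`. -/
def contaminated {d : ℕ} (ε : ℝ) (P Q : Measure (EuclideanSpace ℝ (Fin d))) :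
    Measure (EuclideanSpace ℝ (Fin d)) :=
  ENNReal.ofReal (1 - ε) • P + ENNReal.ofReal ε • Q

/-- The empirical measure of `n ≥ 1` points: mass `1 / n` at each of them. -/
def empiricalLaw {d n : ℕ} (x : Fin n → EuclideanSpace ℝ (Fin d)) :
    Measure (EuclideanSpace ℝ (Fin d)) :=
  (n : ℝ≥0∞)⁻¹ • ∑ i, Measure.dirac (x i)

end

/-!
If `P` is `α`-symmetric, then `⟨X, u⟩` has the law of `‖u‖_α X_1` for every `u`
(`IsAlphaSymmetric.map_inner_eq`), so `P {⟨y, u⟩ ≤ c} = F (c / ‖u‖_α)`, where `F` is the first marginal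
distribution function. All halfspaces with the origin on their boundary thus have the same mass `F 0`, and
the growth condition makes the origin the unique deepest point of `P`
(`IsAlphaSymmetric.halfspaceMedian_eq_zero`).

Suppose a law `ν` agrees with `(1 - ε) P + ε Q` up to `η` on all closed halfspaces. Then the depth of the
origin under `ν` is at least `(1 - ε) F 0 - η`, and a deepest point `x` of `ν` is at least as deep. Its
depth is at most `(1 - ε) F (⟨x, u⟩ / ‖u‖_α) + ε + η` for every direction `u`. Comparing the two and using
the growth condition yields `|⟨x, u⟩| ≤ R ‖u‖_α` with `R = (3 ε / 2 + 3 η) / κ`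
(`IsAlphaSymmetric.abs_inner_medianSet_le`). The points satisfying these inequalities form a compact convex
set, which therefore also contains the barycenter (`abs_inner_barycenter_le`), and duality between the
indices `α` and `β` turns them into `‖x‖_β ≤ R` (`pNorm_conjIndex_le`).

It remains to bound `η` for the empirical law by a multiple of `√(d / n) + √(log (1 / δ) / n)`, without a
logarithmic factor in `n` (`exists_measurableSet_halfspace_deviation`). Halfspaces have VC dimension at most
`d + 1` by Radon's theorem. A second sample and random exchanges between the two samples reduce the claim
to Rademacher sums over the traces of halfspaces on fixed points (`pi_exists_lt_abs_hitCount_sub_le`).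
These sums are bounded by chaining (`card_exists_lt_abs_signedSum_le`), with nets whose sizes are
controlled by a packing bound for families of finite VC dimension (`log_card_le_of_separated`).
Probabilities over signs are expressed by counting sign patterns. Suprema over halfspaces are reduced to a
countable class, which settles measurability.
-/

/-! ### Rademacher sums -/

/-- The Rademacher sign attached to a Boolean. -/
def boolSign (b : Bool) : ℝ := if b then 1 else -1

/-- The signed sum `∑_{i ∈ A} ± 1` attached to a sign pattern and a set of indices. -/
def signedSum {ι : Type*} (σ : ι → Bool) (A : Finset ι) : ℝ := ∑ i ∈ A, boolSign (σ i)

section Rademacher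

variable {ι : Type*} [Fintype ι] [DecidableEq ι]

lemma sum_exp_rademacher_le (c : ι → ℝ) :
    ∑ σ : ι → Bool, Real.exp (∑ i, boolSign (σ i) * c i)
      ≤ Real.exp ((∑ i, c i ^ 2) / 2) * 2 ^ Fintype.card ι := by
  have h1 : ∑ σ : ι → Bool, Real.exp (∑ i, boolSign (σ i) * c i)
      = ∏ i, ∑ b : Bool, Real.exp (boolSign b * c i) := by
    rw [Finset.prod_univ_sum, Fintype.piFinset_univ]
    simp_rw [Real.exp_sum]
  have h2 : ∀ i, ∑ b : Bool, Real.exp (boolSign b * c i) ≤ Real.exp (c i ^ 2 / 2) * 2 := by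
    intro i
    have := Real.cosh_le_exp_half_sq (c i)
    rw [Real.cosh_eq] at this
    simp only [boolSign, Fintype.sum_bool, if_true, Bool.false_eq_true, if_false]
    rw [one_mul, neg_one_mul]
    linarith
  rw [h1]
  calc ∏ i, ∑ b : Bool, Real.exp (boolSign b * c i)
      ≤ ∏ i, Real.exp (c i ^ 2 / 2) * 2 :=
        Finset.prod_le_prod (fun i _ => Finset.sum_nonneg fun b _ => (Real.exp_pos _).le)
          fun i _ => h2 i
    _ = _ := by
        rw [Finset.prod_mul_distrib, ← Real.exp_sum, Finset.sum_div]
        simp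

lemma card_lt_rademacher_le (c : ι → ℝ) {v t : ℝ} (hv : 0 < v) (ht : 0 ≤ t)
    (hc : ∑ i, c i ^ 2 ≤ v) :
    ((Finset.univ.filter fun σ : ι → Bool => t < ∑ i, boolSign (σ i) * c i).card : ℝ)
      ≤ Real.exp (-t ^ 2 / (2 * v)) * 2 ^ Fintype.card ι := by
  set S := Finset.univ.filter fun σ : ι → Bool => t < ∑ i, boolSign (σ i) * c i
  -- the optimal exponential tilt is `t / v`
  have h := sum_exp_rademacher_le (fun i => t / v * c i)
  have h1 : (S.card : ℝ) * Real.exp (t ^ 2 / v)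
      ≤ ∑ σ : ι → Bool, Real.exp (∑ i, boolSign (σ i) * (t / v * c i)) := by
    rw [← nsmul_eq_mul, ← Finset.sum_const]
    refine (Finset.sum_le_sum fun σ hσ => ?_).trans
      (Finset.sum_le_sum_of_subset_of_nonneg (Finset.subset_univ S)
        fun σ _ _ => (Real.exp_pos _).le)
    have hσ' : t < ∑ i, boolSign (σ i) * c i := (Finset.mem_filter.1 hσ).2
    apply Real.exp_le_exp.2
    have : ∑ i, boolSign (σ i) * (t / v * c i) = t / v * ∑ i, boolSign (σ i) * c i := by
      rw [Finset.mul_sum]; exact Finset.sum_congr rfl fun i _ => by ring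
    rw [this, show t ^ 2 / v = t / v * t by ring]
    gcongr
  have h2 : (∑ i, (t / v * c i) ^ 2) / 2 ≤ t ^ 2 / (2 * v) := by
    have : ∑ i, (t / v * c i) ^ 2 = (t / v) ^ 2 * ∑ i, c i ^ 2 := by
      rw [Finset.mul_sum]; exact Finset.sum_congr rfl fun i _ => by ring
    rw [this]
    calc (t / v) ^ 2 * (∑ i, c i ^ 2) / 2 ≤ (t / v) ^ 2 * v / 2 := by gcongr
      _ = t ^ 2 / (2 * v) := by field_simp
  have h3 : (S.card : ℝ) * Real.exp (t ^ 2 / v)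
      ≤ Real.exp (t ^ 2 / (2 * v)) * 2 ^ Fintype.card ι :=
    h1.trans (h.trans (by gcongr))
  have h4 : Real.exp (-t ^ 2 / (2 * v))
      = Real.exp (t ^ 2 / (2 * v)) * (Real.exp (t ^ 2 / v))⁻¹ := by
    rw [← Real.exp_neg, ← Real.exp_add]; congr 1; field_simp; ring
  calc (S.card : ℝ) = S.card * Real.exp (t ^ 2 / v) * (Real.exp (t ^ 2 / v))⁻¹ := by
        field_simp
    _ ≤ Real.exp (t ^ 2 / (2 * v)) * 2 ^ Fintype.card ι * (Real.exp (t ^ 2 / v))⁻¹ := by gcongr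
    _ = _ := by rw [h4]; ring

/-- **Hoeffding's inequality** for Rademacher sums, as a count of sign patterns. -/
lemma card_lt_abs_rademacher_le (c : ι → ℝ) {v t : ℝ} (hv : 0 < v) (ht : 0 ≤ t)
    (hc : ∑ i, c i ^ 2 ≤ v) :
    ((Finset.univ.filter fun σ : ι → Bool => t < |∑ i, boolSign (σ i) * c i|).card : ℝ)
      ≤ 2 * Real.exp (-t ^ 2 / (2 * v)) * 2 ^ Fintype.card ι := by
  have h1 := card_lt_rademacher_le c hv ht hc
  have h2 := card_lt_rademacher_le (fun i => -c i) hv ht (by simpa using hc)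
  have h3 : (Finset.univ.filter fun σ : ι → Bool => t < |∑ i, boolSign (σ i) * c i|) ⊆
      (Finset.univ.filter fun σ : ι → Bool => t < ∑ i, boolSign (σ i) * c i) ∪
      (Finset.univ.filter fun σ : ι → Bool => t < ∑ i, boolSign (σ i) * -c i) := by
    intro σ hσ
    simp only [Finset.mem_filter, Finset.mem_univ, true_and, Finset.mem_union, mul_neg,
      Finset.sum_neg_distrib] at hσ ⊢
    exact lt_abs.1 hσ
  have h4 : ((Finset.univ.filter fun σ : ι → Bool =>
      t < |∑ i, boolSign (σ i) * c i|).card : ℝ) ≤ _ :=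
    Nat.cast_le.2 ((Finset.card_le_card h3).trans (Finset.card_union_le _ _))
  push_cast at h4
  linarith

open scoped symmDiff

lemma card_lt_abs_signedSum_sub_le (A B : Finset ι) {v t : ℝ} (hv : 0 < v) (ht : 0 ≤ t)
    (hAB : ((A ∆ B).card : ℝ) ≤ v) :
    ((Finset.univ.filter fun σ : ι → Bool => t < |signedSum σ A - signedSum σ B|).card : ℝ)
      ≤ 2 * Real.exp (-t ^ 2 / (2 * v)) * 2 ^ Fintype.card ι := by
  let c : ι → ℝ := fun i => (if i ∈ A then 1 else 0) - (if i ∈ B then 1 else 0)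
  have h1 : ∀ σ : ι → Bool, signedSum σ A - signedSum σ B = ∑ i, boolSign (σ i) * c i := by
    intro σ
    simp [c, signedSum, mul_sub, Finset.sum_sub_distrib]
  have h2 : ∑ i, c i ^ 2 = ((A ∆ B).card : ℝ) := by
    have h3 : ∀ i, c i ^ 2 = if i ∈ A ∆ B then 1 else 0 := by
      intro i
      by_cases hA : i ∈ A <;> by_cases hB : i ∈ B <;> simp [c, hA, hB, Finset.mem_symmDiff]
    simp_rw [h3]
    simp
  simp_rw [h1]
  exact card_lt_abs_rademacher_le c hv ht (h2.trans_le hAB)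

end Rademacher

/-! ### Packing numbers of families of bounded VC dimension -/

section Packing

open scoped symmDiff

/-- The **Sauer–Shelah** bound in exponential form. -/
lemma card_le_of_vcDim_le {κ : Type*} [Fintype κ] [DecidableEq κ] (F : Finset (Finset κ)) {D : ℕ}
    (hF : F.vcDim ≤ D) {x : ℝ} (hx : 0 < x) (hx1 : x ≤ 1) :
    (F.card : ℝ) ≤ x⁻¹ ^ D * Real.exp (x * Fintype.card κ) := by
  have h0 : F.card ≤ ∑ k ∈ Finset.Iic F.vcDim, (Fintype.card κ).choose k :=
    F.card_le_card_shatterer.trans Finset.card_shatterer_le_sum_vcDim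
  set m := Fintype.card κ
  have hx' : 1 ≤ x⁻¹ := (one_le_inv₀ hx).2 hx1
  have h1 : ∀ k ∈ Finset.Iic F.vcDim, (m.choose k : ℝ) ≤ x⁻¹ ^ D * (x ^ k * m.choose k) := by
    intro k hk
    have hkD : k ≤ D := (Finset.mem_Iic.1 hk).trans hF
    have : 1 ≤ x⁻¹ ^ D * x ^ k := by
      calc (1 : ℝ) = x⁻¹ ^ k * x ^ k := by rw [← mul_pow, inv_mul_cancel₀ hx.ne', one_pow]
        _ ≤ x⁻¹ ^ D * x ^ k := by gcongr
    rw [← mul_assoc]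
    exact le_mul_of_one_le_left (Nat.cast_nonneg _) this
  have h2 : ∑ k ∈ Finset.Iic F.vcDim, x ^ k * (m.choose k : ℝ) ≤ (x + 1) ^ m := by
    have hbin : (x + 1) ^ m = ∑ k ∈ Finset.range (m + 1), x ^ k * (m.choose k : ℝ) := by
      rw [add_pow]; simp
    rw [hbin]
    have hs : ∑ k ∈ Finset.Iic F.vcDim, x ^ k * (m.choose k : ℝ)
        = ∑ k ∈ (Finset.Iic F.vcDim).filter (· < m + 1), x ^ k * (m.choose k : ℝ) := by
      rw [Finset.sum_filter]
      refine Finset.sum_congr rfl fun k _ => ?_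
      split_ifs with h
      · rfl
      · rw [Nat.choose_eq_zero_of_lt (by omega)]; simp
    rw [hs]
    refine Finset.sum_le_sum_of_subset_of_nonneg ?_ fun k _ _ => by positivity
    intro k hk
    exact Finset.mem_range.2 (Finset.mem_filter.1 hk).2
  calc (F.card : ℝ) ≤ ∑ k ∈ Finset.Iic F.vcDim, (m.choose k : ℝ) := by exact_mod_cast h0
    _ ≤ ∑ k ∈ Finset.Iic F.vcDim, x⁻¹ ^ D * (x ^ k * m.choose k) := Finset.sum_le_sum h1
    _ = x⁻¹ ^ D * ∑ k ∈ Finset.Iic F.vcDim, x ^ k * (m.choose k : ℝ) := by rw [Finset.mul_sum]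
    _ ≤ x⁻¹ ^ D * (x + 1) ^ m := by gcongr
    _ ≤ x⁻¹ ^ D * Real.exp x ^ m := by gcongr; exact Real.add_one_le_exp x
    _ = _ := by rw [← Real.exp_nat_mul, mul_comm (m : ℝ) x]

lemma vcDim_image_preimage_le {ι κ : Type*} [DecidableEq ι] [Fintype κ] [DecidableEq κ]
    (F : Finset (Finset ι))
    (s : κ → ι) :
    (F.image fun A => Finset.univ.filter fun j => s j ∈ A).vcDim ≤ F.vcDim := by
  refine Finset.sup_le fun T hT => ?_
  rw [Finset.mem_shatterer] at hT
  have key : ∀ U ⊆ T, ∃ A ∈ F, ∀ j ∈ T, j ∈ U ↔ s j ∈ A := by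
    intro U hU
    obtain ⟨V, hV, hTV⟩ := hT hU
    obtain ⟨A, hA, rfl⟩ := Finset.mem_image.1 hV
    refine ⟨A, hA, fun j hj => ?_⟩
    rw [← hTV]; simp [hj]
  have hinj : Set.InjOn s T := by
    intro a ha b hb hab
    obtain ⟨A, -, hA⟩ := key {a} (by simpa using ha)
    have h1 := (hA a ha).1 (by simp)
    rw [hab] at h1
    exact (Finset.mem_singleton.1 ((hA b hb).2 h1)).symm
  rw [← Finset.card_image_of_injOn hinj]
  refine Finset.Shatters.card_le_vcDim fun W hW => ?_
  obtain ⟨A, hA, hAU⟩ := key (T.filter fun j => s j ∈ W) (Finset.filter_subset _ _)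
  refine ⟨A, hA, ?_⟩
  ext i
  simp only [Finset.mem_inter, Finset.mem_image]
  constructor
  · rintro ⟨⟨j, hj, rfl⟩, hi⟩
    exact (Finset.mem_filter.1 ((hAU j hj).2 hi)).2
  · intro hi
    obtain ⟨j, hj, rfl⟩ := Finset.mem_image.1 (hW hi)
    exact ⟨⟨j, hj, rfl⟩, (hAU j hj).1 (Finset.mem_filter.2 ⟨hj, hi⟩)⟩

variable {ι : Type*} [Fintype ι] [DecidableEq ι]

/-- A random `m`-tuple of indices separates all members of a family of pairwise distant sets, as soon
as `m` is logarithmic in the size of the family. -/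
lemma exists_separating_tuple (F : Finset (Finset ι)) {r : ℝ} (hr1 : r ≤ 1) (m : ℕ)
    (hn : 0 < Fintype.card ι)
    (hsep : ∀ A ∈ F, ∀ B ∈ F, A ≠ B → r * Fintype.card ι ≤ ((A ∆ B).card : ℝ))
    (hm : (F.card : ℝ) ^ 2 * Real.exp (-(r * m)) < 1) :
    ∃ s : Fin m → ι, Set.InjOn (fun A : Finset ι => Finset.univ.filter fun j => s j ∈ A) F := by
  classical
  set n := Fintype.card ι with hn_def
  by_contra! hcon
  have hcov : (Finset.univ : Finset (Fin m → ι)) ⊆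
      F.offDiag.biUnion fun p => Fintype.piFinset fun _ => (p.1 ∆ p.2)ᶜ := by
    intro s _
    have := hcon s
    simp only [Set.InjOn, not_forall] at this
    obtain ⟨A, hA, B, hB, hAB, hne⟩ := this
    refine Finset.mem_biUnion.2 ⟨(A, B), Finset.mem_offDiag.2 ⟨hA, hB, hne⟩, ?_⟩
    refine Fintype.mem_piFinset.2 fun j => ?_
    have := Finset.ext_iff.1 hAB j
    simp only [Finset.mem_filter, Finset.mem_univ, true_and] at this
    simp only [Finset.mem_compl, Finset.mem_symmDiff]
    tauto
  have hcard : ((n : ℝ)) ^ m ≤ (F.card : ℝ) ^ 2 * ((1 - r) * n) ^ m := by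
    have h1 := (Finset.card_le_card hcov).trans Finset.card_biUnion_le
    have h2 : (Finset.univ : Finset (Fin m → ι)).card = n ^ m := by simp [n]
    rw [h2] at h1
    have h3 : ((n : ℝ)) ^ m
        ≤ ∑ p ∈ F.offDiag, ((Fintype.piFinset fun _ : Fin m => (p.1 ∆ p.2)ᶜ).card : ℝ) := by
      exact_mod_cast h1
    refine h3.trans ?_
    have h4 : ∀ p ∈ F.offDiag, ((Fintype.piFinset fun _ : Fin m => (p.1 ∆ p.2)ᶜ).card : ℝ)
        ≤ ((1 - r) * n) ^ m := by
      intro p hp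
      obtain ⟨hA, hB, hne⟩ := Finset.mem_offDiag.1 hp
      have h5 := hsep _ hA _ hB hne
      rw [Fintype.card_piFinset]
      simp only [Finset.prod_const, Finset.card_univ, Fintype.card_fin]
      push_cast
      gcongr
      rw [Finset.card_compl, Nat.cast_sub (Finset.card_le_univ _)]
      linarith
    refine (Finset.sum_le_sum h4).trans ?_
    rw [Finset.sum_const, nsmul_eq_mul, Finset.offDiag_card]
    have h6 : 0 ≤ ((1 - r) * n) ^ m := by
      have : 0 ≤ 1 - r := by linarith
      positivity
    gcongr
    rw [sq]
    exact_mod_cast Nat.sub_le _ _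
  have hnpos : (0 : ℝ) < (n : ℝ) ^ m := by positivity
  have h7 : (1 - r) ^ m ≤ Real.exp (-(r * m)) := by
    calc (1 - r) ^ m ≤ Real.exp (-r) ^ m := by
          have : 0 ≤ 1 - r := by linarith
          gcongr
          exact Real.one_sub_le_exp_neg r
      _ = _ := by rw [← Real.exp_nat_mul]; congr 1; ring
  have h8 : (F.card : ℝ) ^ 2 * ((1 - r) * n) ^ m < (n : ℝ) ^ m := by
    rw [mul_pow, ← mul_assoc]
    calc (F.card : ℝ) ^ 2 * (1 - r) ^ m * (n : ℝ) ^ m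
        ≤ (F.card : ℝ) ^ 2 * Real.exp (-(r * m)) * (n : ℝ) ^ m := by gcongr
      _ < 1 * (n : ℝ) ^ m := by gcongr
      _ = _ := one_mul _
  linarith

/-- Packing bound for families of bounded VC dimension. Sampling `m ≈ 2 log |F| / r` indices keeps the
members distinct, and the Sauer–Shelah bound with parameter `x = r / 4` costs at most half of `log |F|`,
so no self-referential inequality has to be solved. -/
lemma log_card_le_of_separated (F : Finset (Finset ι)) {D : ℕ} (hF : F.vcDim ≤ D)
    {r : ℝ} (hr : 0 < r) (hr1 : r ≤ 1) (hn : 0 < Fintype.card ι) (hne : F.Nonempty)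
    (hsep : ∀ A ∈ F, ∀ B ∈ F, A ≠ B → r * Fintype.card ι ≤ ((A ∆ B).card : ℝ)) :
    Real.log F.card ≤ 2 * D * Real.log (4 / r) + 1 / 2 := by
  have hN : (1 : ℝ) ≤ F.card := by exact_mod_cast hne.card_pos
  have hlog : 0 ≤ Real.log F.card := Real.log_nonneg hN
  set L := Real.log F.card
  set m := ⌊2 * L / r⌋₊ + 1
  have hm1 : 2 * L < r * m := by
    have := Nat.lt_floor_add_one (2 * L / r)
    rw [div_lt_iff₀ hr] at this
    push_cast [m]; linarith
  have hm2 : r * m ≤ 2 * L + 1 := by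
    have := Nat.floor_le (show 0 ≤ 2 * L / r by positivity)
    rw [le_div_iff₀ hr] at this
    push_cast [m]; nlinarith
  have hexp : Real.exp L = F.card := Real.exp_log (by linarith)
  obtain ⟨s, hs⟩ := exists_separating_tuple F hr1 m hn hsep (by
    rw [← hexp, ← Real.exp_nat_mul, ← Real.exp_add, Real.exp_lt_one_iff]
    push_cast; linarith)
  have h1 := card_le_of_vcDim_le (F.image fun A => Finset.univ.filter fun j => s j ∈ A)
    ((vcDim_image_preimage_le F s).trans hF) (x := r / 4) (by positivity) (by linarith)
  rw [Finset.card_image_of_injOn hs, Fintype.card_fin] at h1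
  have h2 : L ≤ Real.log ((r / 4)⁻¹ ^ D * Real.exp (r / 4 * m)) :=
    Real.log_le_log (by linarith) h1
  rw [Real.log_mul (by positivity) (by positivity), Real.log_exp, Real.log_pow, inv_div] at h2
  linarith

end Packing

/-! ### Chaining for the Rademacher process -/

section Chaining

open scoped symmDiff

lemma exists_separated_net {ι : Type*} [DecidableEq ι] (F : Finset (Finset ι)) (q : ℝ) :
    ∃ N ⊆ F, (∀ A ∈ N, ∀ B ∈ N, A ≠ B → q < ((A ∆ B).card : ℝ)) ∧
      (0 ≤ q → ∀ A ∈ F, ∃ B ∈ N, ((A ∆ B).card : ℝ) ≤ q) := by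
  classical
  obtain ⟨N, hN, hmax⟩ := Finset.exists_max_image
    (F.powerset.filter fun N => ∀ A ∈ N, ∀ B ∈ N, A ≠ B → q < ((A ∆ B).card : ℝ)) Finset.card
    ⟨∅, by simp⟩
  rw [Finset.mem_filter, Finset.mem_powerset] at hN
  refine ⟨N, hN.1, hN.2, fun hq A hA => ?_⟩
  by_contra! hcon
  have hAN : A ∉ N := fun h => by
    have := hcon A h
    simp at this; linarith
  have := hmax (insert A N) (by
    rw [Finset.mem_filter, Finset.mem_powerset]
    refine ⟨Finset.insert_subset hA hN.1, fun B hB C hC hBC => ?_⟩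
    rcases Finset.mem_insert.1 hB with hB' | hB' <;> rcases Finset.mem_insert.1 hC with hC' | hC'
    · exact absurd (hB'.trans hC'.symm) hBC
    · rw [hB']; exact hcon C hC'
    · rw [hC', symmDiff_comm]; exact hcon B hB'
    · exact hN.2 B hB' C hC' hBC)
  rw [Finset.card_insert_of_notMem hAN] at this
  omega

lemma sum_chaining_weights_le (m : ℕ) :
    ∑ j ∈ Finset.range m, 2 * ((j : ℝ) + 1) / 2 ^ j ≤ 8 := by
  have : ∑ j ∈ Finset.range m, 2 * ((j : ℝ) + 1) / 2 ^ j = 8 - (4 * m + 8) / 2 ^ m := by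
    induction m with
    | zero => norm_num
    | succ k ih => rw [Finset.sum_range_succ, ih]; push_cast; field_simp; ring
  rw [this]
  have : 0 ≤ (4 * (m : ℝ) + 8) / 2 ^ m := by positivity
  linarith

lemma sum_half_pow_le (m : ℕ) : ∑ j ∈ Finset.range m, (1 / 2 : ℝ) ^ (j + 1) ≤ 1 := by
  have : ∑ j ∈ Finset.range m, (1 / 2 : ℝ) ^ (j + 1) = 1 - (1 / 2) ^ m := by
    induction m with
    | zero => norm_num
    | succ k ih => rw [Finset.sum_range_succ, ih]; ring
  rw [this]
  have : 0 ≤ (1 / 2 : ℝ) ^ m := by positivity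
  linarith

variable {ι : Type*} [Fintype ι] [DecidableEq ι]

/-- **Chaining bound** for the Rademacher process over a family of bounded VC dimension. The nets at
scale `4⁻ᵏ n` have logarithmic cardinality of order `D (k + 1)`, so the increments between consecutive
scales form a convergent series, and no logarithmic factor in `n` appears. -/
theorem card_exists_lt_abs_signedSum_le (F : Finset (Finset ι)) {D : ℕ} (hF : F.vcDim ≤ D)
    (hD : 1 ≤ D) (hn : 0 < Fintype.card ι) {L : ℝ} (hL : 0 ≤ L) :
    ((Finset.univ.filter fun σ : ι → Bool => ∃ A ∈ F,
        8 * √(2 * Fintype.card ι * (6 * D + L)) < |signedSum σ A|).card : ℝ)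
      ≤ Real.exp (-L) * 2 ^ Fintype.card ι := by
  set n := Fintype.card ι with hn_def
  have hn' : (0 : ℝ) < n := by exact_mod_cast hn
  have hD' : (1 : ℝ) ≤ D := by exact_mod_cast hD
  set T := √(2 * n * (6 * D + L)) with hT
  have hT2 : T ^ 2 = 2 * n * (6 * D + L) := Real.sq_sqrt (by positivity)
  have hT0 : 0 ≤ T := Real.sqrt_nonneg _
  choose N hNF hNsep hNnet using fun k : ℕ => exists_separated_net F ((n : ℝ) / 4 ^ k)
  choose! π hπN hπ using fun k : ℕ => hNnet k (by positivity)
  -- the parent of a set of level `k`; the root of the chain is the empty set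
  let par : ℕ → Finset ι → Finset ι := fun k A => if k = 0 then ∅ else π (k - 1) A
  -- The threshold at level `k` makes the Hoeffding exponent at least `(k + 1) (6 D + L)`, which beats the
  -- logarithm `4 D (k + 1)` of the net size.
  let t : ℕ → ℝ := fun k => 2 * ((k : ℝ) + 1) / 2 ^ k * T
  have ht0 : ∀ k, 0 ≤ t k := fun k => by positivity
  let bad : ℕ → Finset (ι → Bool) := fun k =>
    (N k).biUnion fun A => Finset.univ.filter fun σ => t k < |signedSum σ A - signedSum σ (par k A)|
  have hdist : ∀ k, ∀ A ∈ F, ((A ∆ par k A).card : ℝ) ≤ 4 * n / 4 ^ k := by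
    intro k A hA
    rcases k with _ | k
    · have h1 : ((A.card : ℕ) : ℝ) ≤ n := by exact_mod_cast Finset.card_le_univ A
      have h2 : A ∆ par 0 A = A := by simp [par]
      rw [h2, pow_zero, div_one]
      linarith
    · have := hπ k A hA
      have h2 : par (k + 1) A = π k A := by simp [par]
      rw [h2]
      refine this.trans (le_of_eq ?_)
      rw [pow_succ]; field_simp
  have hcardN : ∀ k, ((N k).card : ℝ) ≤ Real.exp (4 * D * (k + 1)) := by
    intro k
    rcases (N k).eq_empty_or_nonempty with h | h
    · rw [h]; simp; positivity
    · have h1 := log_card_le_of_separated (N k) ((Finset.vcDim_mono (hNF k)).trans hF)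
        (r := 1 / 4 ^ k) (by positivity)
        (by rw [div_le_one (by positivity)]; exact one_le_pow₀ (by norm_num)) hn h
        (fun A hA B hB hAB => by
          have := hNsep k A hA B hB hAB
          rw [one_div_mul_eq_div]; exact this.le)
      have h2 : Real.log (4 / (1 / 4 ^ k)) = (k + 1) * (2 * Real.log 2) := by
        rw [div_div_eq_mul_div, div_one, ← pow_succ', Real.log_pow,
          show (4 : ℝ) = 2 ^ 2 by norm_num, Real.log_pow]
        push_cast; ring
      rw [h2] at h1
      have h3 := Real.log_two_lt_d9
      have h4 : (1 : ℝ) ≤ D * (k + 1) := by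
        have : (0 : ℝ) ≤ k := Nat.cast_nonneg k
        nlinarith
      have h5 : Real.log (N k).card ≤ 4 * D * (k + 1) := by nlinarith
      have hpos : (0 : ℝ) < (N k).card := by exact_mod_cast h.card_pos
      rw [← Real.exp_log hpos]
      exact Real.exp_le_exp.2 h5
  have hbad : ∀ k, ((bad k).card : ℝ) ≤ (1 / 2) ^ (k + 1) * (Real.exp (-L) * 2 ^ n) := by
    intro k
    have hk : (0 : ℝ) ≤ k := Nat.cast_nonneg k
    have h1 : ((bad k).card : ℝ) ≤ ∑ A ∈ N k, ((Finset.univ.filter fun σ : ι → Bool =>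
        t k < |signedSum σ A - signedSum σ (par k A)|).card : ℝ) := by
      exact_mod_cast Finset.card_biUnion_le
    have h2 : ∀ A ∈ N k, ((Finset.univ.filter fun σ : ι → Bool =>
        t k < |signedSum σ A - signedSum σ (par k A)|).card : ℝ)
          ≤ 2 * Real.exp (-((k + 1) * (6 * D + L))) * 2 ^ n := by
      intro A hA
      refine (card_lt_abs_signedSum_sub_le A (par k A) (v := 4 * n / 4 ^ k) (by positivity) (ht0 k)
        (hdist k A (hNF k hA))).trans ?_
      gcongr
      have h3 : t k ^ 2 / (2 * (4 * n / 4 ^ k)) = (k + 1) ^ 2 * (6 * D + L) := by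
        have : ((2 : ℝ) ^ k) ^ 2 = 4 ^ k := by rw [← pow_mul, mul_comm, pow_mul]; norm_num
        simp only [t]
        rw [mul_pow, div_pow, hT2, this]
        field_simp; ring
      rw [neg_div, h3]
      apply neg_le_neg
      gcongr
      nlinarith
    refine h1.trans ((Finset.sum_le_sum h2).trans ?_)
    rw [Finset.sum_const, nsmul_eq_mul]
    have h4 : Real.exp (4 * D * (k + 1)) * Real.exp (-((k + 1) * (6 * D + L)))
        ≤ Real.exp (-(2 * (k + 1))) * Real.exp (-L) := by
      rw [← Real.exp_add, ← Real.exp_add]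
      apply Real.exp_le_exp.2
      nlinarith [mul_nonneg hk hL, mul_nonneg hk (sub_nonneg.2 hD')]
    have h5 : 2 * Real.exp (-(2 * ((k : ℝ) + 1))) ≤ (1 / 2) ^ (k + 1) := by
      have h6 : Real.exp (-(2 * ((k : ℝ) + 1))) ≤ (1 / 4) ^ (k + 1) := by
        have : Real.exp (-(2 * ((k : ℝ) + 1))) = Real.exp (-2) ^ (k + 1) := by
          rw [← Real.exp_nat_mul]; congr 1; push_cast; ring
        rw [this]
        gcongr
        have h7 : (2 : ℝ) ≤ Real.exp 1 := by have := Real.add_one_le_exp (1 : ℝ); linarith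
        have h8 : Real.exp 2 = Real.exp 1 * Real.exp 1 := by rw [← Real.exp_add]; norm_num
        rw [Real.exp_neg, one_div]
        gcongr
        nlinarith
      have h9 : (1 / 4 : ℝ) ^ (k + 1) = (1 / 2) ^ (k + 1) * (1 / 2) ^ (k + 1) := by
        rw [← mul_pow]; norm_num
      have h10 : (1 / 2 : ℝ) ^ (k + 1) ≤ 1 / 2 := by
        rw [pow_succ]
        have : (1 / 2 : ℝ) ^ k ≤ 1 := pow_le_one₀ (by norm_num) (by norm_num)
        linarith
      have h11 : (0 : ℝ) < (1 / 2) ^ (k + 1) := by positivity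
      nlinarith
    calc ((N k).card : ℝ) * (2 * Real.exp (-((k + 1) * (6 * D + L))) * 2 ^ n)
        ≤ Real.exp (4 * D * (k + 1)) * (2 * Real.exp (-((k + 1) * (6 * D + L))) * 2 ^ n) := by
          gcongr; exact hcardN k
      _ = 2 * (Real.exp (4 * D * (k + 1)) * Real.exp (-((k + 1) * (6 * D + L)))) * 2 ^ n := by
          ring
      _ ≤ 2 * (Real.exp (-(2 * (k + 1))) * Real.exp (-L)) * 2 ^ n := by gcongr
      _ = 2 * Real.exp (-(2 * (k + 1))) * (Real.exp (-L) * 2 ^ n) := by ring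
      _ ≤ _ := by gcongr
  -- at a scale below one index the net is the whole family
  obtain ⟨K, hK⟩ : ∃ K : ℕ, (n : ℝ) < 4 ^ K := pow_unbounded_of_one_lt _ (by norm_num)
  have hgood : ∀ σ : ι → Bool, (∀ k < K + 1, σ ∉ bad k) → ∀ k < K + 1, ∀ A ∈ N k,
      |signedSum σ A| ≤ ∑ j ∈ Finset.range (k + 1), t j := by
    intro σ hσ k
    induction k with
    | zero =>
      intro hk A hA
      have h1 := hσ 0 hk
      simp only [bad, Finset.mem_biUnion, Finset.mem_filter, Finset.mem_univ, true_and, not_exists,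
        not_and, not_lt] at h1
      simpa [par, signedSum] using h1 A hA
    | succ k ih =>
      intro hk A hA
      have h1 := hσ (k + 1) hk
      simp only [bad, Finset.mem_biUnion, Finset.mem_filter, Finset.mem_univ, true_and, not_exists,
        not_and, not_lt] at h1
      have h2 := h1 A hA
      have h3 : par (k + 1) A = π k A := by simp [par]
      rw [h3] at h2
      have h4 := ih (by omega) (π k A) (hπN k A (hNF _ hA))
      rw [Finset.sum_range_succ]
      have h5 := abs_sub_abs_le_abs_sub (signedSum σ A) (signedSum σ (π k A))
      linarith
  have hsub : (Finset.univ.filter fun σ : ι → Bool => ∃ A ∈ F, 8 * T < |signedSum σ A|) ⊆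
      (Finset.range (K + 1)).biUnion bad := by
    intro σ hσ
    obtain ⟨A, hA, hlt⟩ := (Finset.mem_filter.1 hσ).2
    by_contra hcon
    have hcon' : ∀ k < K + 1, σ ∉ bad k := fun k hk hmem =>
      hcon (Finset.mem_biUnion.2 ⟨k, Finset.mem_range.2 hk, hmem⟩)
    have hAK : A ∈ N K := by
      have h1 := hπ K A hA
      have h2 : (n : ℝ) / 4 ^ K < 1 := (div_lt_one (by positivity)).2 hK
      have h3 : (A ∆ π K A).card = 0 := by
        have : ((A ∆ π K A).card : ℝ) < 1 := h1.trans_lt h2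
        exact Nat.lt_one_iff.1 (by exact_mod_cast this)
      have h4 : A = π K A := symmDiff_eq_bot.1 (Finset.card_eq_zero.1 h3)
      rw [h4]; exact hπN K A hA
    have h5 := hgood σ hcon' K (by omega) A hAK
    have h6 : ∑ j ∈ Finset.range (K + 1), t j ≤ 8 * T := by
      simp only [t]
      rw [← Finset.sum_mul]
      gcongr
      exact sum_chaining_weights_le _
    linarith
  have h1 : ((Finset.univ.filter fun σ : ι → Bool => ∃ A ∈ F, 8 * T < |signedSum σ A|).card : ℝ)
      ≤ ∑ k ∈ Finset.range (K + 1), ((bad k).card : ℝ) := by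
    exact_mod_cast (Finset.card_le_card hsub).trans Finset.card_biUnion_le
  refine h1.trans ((Finset.sum_le_sum fun k _ => hbad k).trans ?_)
  rw [← Finset.sum_mul]
  exact mul_le_of_le_one_left (by positivity) (sum_half_pow_le _)

end Chaining

/-! ### Uniform law of large numbers over a class of bounded VC dimension -/

section UniformDeviation

variable {E : Type*} {n : ℕ}

/-- The number of coordinates of `x` that lie in `S`. -/
noncomputable def hitCount (S : Set E) (x : Fin n → E) : ℝ := ∑ i, S.indicator 1 (x i)

open Classical in
/-- The traces of the sets `h j` on the points of the tuple `x`, as sets of indices. -/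
noncomputable def traceFamily {J : Type*} (h : J → Set E) (x : Fin n → E) : Finset (Finset (Fin n)) :=
  Finset.univ.filter fun A => ∃ j, A = Finset.univ.filter fun i => x i ∈ h j

/-- Symmetrized deviations over a class with VC dimension at most `D` are uniformly of order
`√(n (D + L))` for all but a proportion `2 exp (-L)` of sign patterns. -/
lemma card_exists_lt_abs_signed_hits_le {J : Type*} (h : J → Set E) {D : ℕ} (hD : 1 ≤ D)
    (hVC : ∀ x : Fin n → E, (traceFamily h x).vcDim ≤ D) (hn : 0 < n) {L : ℝ} (hL : 0 ≤ L)
    (w : Fin n → E × E) :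
    Nat.card {σ : Fin n → Bool // ∃ j, 16 * √(2 * n * (6 * D + L)) <
        |∑ i, boolSign (σ i) * ((h j).indicator 1 (w i).1 - (h j).indicator 1 (w i).2)|}
      ≤ 2 * Real.exp (-L) * 2 ^ n := by
  classical
  set T := √(2 * n * (6 * D + L)) with hT
  have key : ∀ x : Fin n → E, ((Finset.univ.filter fun σ : Fin n → Bool =>
      ∃ A ∈ traceFamily h x, 8 * T < |signedSum σ A|).card : ℝ) ≤ Real.exp (-L) * 2 ^ n := by
    intro x
    have := card_exists_lt_abs_signedSum_le (traceFamily h x) (hVC x) hD (by simpa using hn) hL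
    simpa [hT] using this
  have hsum : ∀ (x : Fin n → E) (σ : Fin n → Bool) (j : J),
      ∑ i, boolSign (σ i) * (h j).indicator 1 (x i)
        = signedSum σ (Finset.univ.filter fun i => x i ∈ h j) := by
    intro x σ j
    rw [signedSum, Finset.sum_filter]
    refine Finset.sum_congr rfl fun i _ => ?_
    by_cases hi : x i ∈ h j <;> simp [hi]
  have hmem : ∀ (x : Fin n → E) (j : J),
      (Finset.univ.filter fun i => x i ∈ h j) ∈ traceFamily h x := fun x j =>
    Finset.mem_filter.2 ⟨Finset.mem_univ _, j, by congr⟩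
  have hsub : (Finset.univ.filter fun σ : Fin n → Bool => ∃ j, 16 * T <
        |∑ i, boolSign (σ i) * ((h j).indicator 1 (w i).1 - (h j).indicator 1 (w i).2)|) ⊆
      (Finset.univ.filter fun σ : Fin n → Bool =>
        ∃ A ∈ traceFamily h (fun i => (w i).1), 8 * T < |signedSum σ A|) ∪
      (Finset.univ.filter fun σ : Fin n → Bool =>
        ∃ A ∈ traceFamily h (fun i => (w i).2), 8 * T < |signedSum σ A|) := by
    intro σ hσ
    obtain ⟨j, hj⟩ := (Finset.mem_filter.1 hσ).2
    simp_rw [mul_sub, Finset.sum_sub_distrib] at hj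
    rw [hsum (fun i => (w i).1), hsum (fun i => (w i).2)] at hj
    rw [Finset.mem_union, Finset.mem_filter, Finset.mem_filter]
    by_contra! hcon
    have h1 := hcon.1 (Finset.mem_univ _) _ (hmem (fun i => (w i).1) j)
    have h2 := hcon.2 (Finset.mem_univ _) _ (hmem (fun i => (w i).2) j)
    have h3 := abs_sub (signedSum σ (Finset.univ.filter fun i => (w i).1 ∈ h j))
      (signedSum σ (Finset.univ.filter fun i => (w i).2 ∈ h j))
    linarith
  have h1 := (Finset.card_le_card hsub).trans (Finset.card_union_le _ _)
  rw [Nat.card_eq_fintype_card, Fintype.card_subtype]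
  have h2 : ((Finset.univ.filter fun σ : Fin n → Bool => ∃ j, 16 * T <
        |∑ i, boolSign (σ i) * ((h j).indicator 1 (w i).1 - (h j).indicator 1 (w i).2)|).card : ℝ)
      ≤ _ := Nat.cast_le.2 h1
  push_cast at h2
  linarith [key fun i => (w i).1, key fun i => (w i).2]

variable [MeasurableSpace E] (M : Measure E) [IsProbabilityMeasure M]

/-- **Symmetrization**: exchanging the two coordinates of the pairs selected by `σ` preserves the law
of the double sample, so the probability of a large deviation between the two half-samples is an
average over sign patterns. -/
lemma pi_prod_exists_lt_abs_le {J : Type*} [Countable J] (h : J → Set E)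
    (hmeas : ∀ j, MeasurableSet (h j)) {D : ℕ} (hD : 1 ≤ D)
    (hVC : ∀ x : Fin n → E, (traceFamily h x).vcDim ≤ D) (hn : 0 < n) {L : ℝ} (hL : 0 ≤ L) :
    (Measure.pi fun _ : Fin n => M.prod M) {w | ∃ j, 16 * √(2 * n * (6 * D + L)) <
        |∑ i, ((h j).indicator (1 : E → ℝ) (w i).1 - (h j).indicator 1 (w i).2)|}
      ≤ ENNReal.ofReal (2 * Real.exp (-L)) := by
  classical
  set s := 16 * √(2 * n * (6 * D + L))
  set ν := Measure.pi fun _ : Fin n => M.prod M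
  let B : (Fin n → Bool) → Set (Fin n → E × E) := fun σ => {w | ∃ j, s <
    |∑ i, boolSign (σ i) * ((h j).indicator (1 : E → ℝ) (w i).1 - (h j).indicator 1 (w i).2)|}
  set B₀ : Set (Fin n → E × E) := {w | ∃ j, s <
    |∑ i, ((h j).indicator (1 : E → ℝ) (w i).1 - (h j).indicator 1 (w i).2)|}
  have hind : ∀ j, Measurable ((h j).indicator (1 : E → ℝ)) := fun j =>
    measurable_one.indicator (hmeas j)
  have hBmeas : ∀ σ, MeasurableSet (B σ) := by
    intro σ
    simp only [B, Set.ofPred_exists]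
    refine MeasurableSet.iUnion fun j => measurableSet_lt measurable_const ?_
    refine Measurable.abs (Finset.measurable_sum _ fun i _ => Measurable.const_mul ?_ _)
    exact ((hind j).comp (measurable_fst.comp (measurable_pi_apply i))).sub
      ((hind j).comp (measurable_snd.comp (measurable_pi_apply i)))
  have hB₀meas : MeasurableSet B₀ := by
    have : B₀ = B fun _ => true := by simp [B, B₀, boolSign]
    rw [this]; exact hBmeas _
  have hswap : ∀ σ, ν (B σ) = ν B₀ := by
    intro σ
    let f : Fin n → E × E → E × E := fun i => if σ i then id else Prod.swap
    have hf : ∀ i, MeasurePreserving (f i) (M.prod M) (M.prod M) := by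
      intro i
      by_cases hi : σ i
      · simp only [f, hi, if_true]; exact MeasurePreserving.id _
      · simp only [f, hi]; exact Measure.measurePreserving_swap
    have hF := measurePreserving_pi (fun _ : Fin n => M.prod M) (fun _ : Fin n => M.prod M) hf
    rw [← hF.measure_preimage hB₀meas.nullMeasurableSet]
    congr 1
    ext w
    simp only [B, B₀, Set.mem_ofPred_eq, Set.mem_preimage]
    refine exists_congr fun j => ?_
    have : ∀ i, (h j).indicator (1 : E → ℝ) (f i (w i)).1 - (h j).indicator 1 (f i (w i)).2
        = boolSign (σ i) * ((h j).indicator (1 : E → ℝ) (w i).1 - (h j).indicator 1 (w i).2) := by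
      intro i
      by_cases hi : σ i
      · simp [f, hi, boolSign]
      · simp [f, hi, boolSign]
    simp_rw [this]
  have hcount : (2 : ℝ≥0∞) ^ n * ν B₀ ≤ ENNReal.ofReal (2 * Real.exp (-L)) * 2 ^ n := by
    calc (2 : ℝ≥0∞) ^ n * ν B₀ = ∑ σ : Fin n → Bool, ν (B σ) := by
          simp [hswap]
      _ = ∑ σ : Fin n → Bool, ∫⁻ w, (B σ).indicator 1 w ∂ν := by
          simp_rw [lintegral_indicator_one (hBmeas _)]
      _ = ∫⁻ w, ∑ σ : Fin n → Bool, (B σ).indicator 1 w ∂ν := by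
          rw [lintegral_finsetSum _ fun σ _ => measurable_one.indicator (hBmeas σ)]
      _ ≤ ∫⁻ w, ENNReal.ofReal (2 * Real.exp (-L)) * 2 ^ n ∂ν := by
          refine lintegral_mono fun w => ?_
          have h1 := card_exists_lt_abs_signed_hits_le h hD hVC hn hL w
          have h2 : ∑ σ : Fin n → Bool, (B σ).indicator (1 : (Fin n → E × E) → ℝ≥0∞) w
              = (Nat.card {σ : Fin n → Bool // w ∈ B σ} : ℝ≥0∞) := by
            rw [Nat.card_eq_fintype_card, Fintype.card_subtype, Finset.card_filter]
            push_cast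
            exact Finset.sum_congr rfl fun σ _ => by simp [Set.indicator_apply]
          have h3 : (Nat.card {σ : Fin n → Bool // w ∈ B σ} : ℝ≥0∞)
              = ENNReal.ofReal (Nat.card {σ : Fin n → Bool // w ∈ B σ}) := by simp
          simp only
          rw [h2, h3]
          refine (ENNReal.ofReal_le_ofReal h1).trans (le_of_eq ?_)
          rw [ENNReal.ofReal_mul (by positivity), ENNReal.ofReal_pow (by norm_num)]
          simp
      _ = _ := by simp
  rw [mul_comm] at hcount
  exact (ENNReal.mul_le_mul_iff_left (by simp) (by simp)).1 hcount

/-- Chebyshev's inequality for the number of hits, which has variance at most `n / 4`. -/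
lemma half_le_pi_abs_hitCount_sub_le {S : Set E} (hS : MeasurableSet S) {s : ℝ} (hs : 0 < s)
    (hns : n ≤ 2 * s ^ 2) :
    1 / 2 ≤ (Measure.pi fun _ : Fin n => M) {x | |hitCount S x - n * M.real S| ≤ s} := by
  set μ := Measure.pi fun _ : Fin n => M
  let Y : Fin n → (Fin n → E) → ℝ := fun i x => S.indicator 1 (x i)
  have hind : Measurable (S.indicator (1 : E → ℝ)) := measurable_one.indicator hS
  have hYm : ∀ i, Measurable (Y i) := fun i => hind.comp (measurable_pi_apply i)
  have hY01 : ∀ i x, Y i x ∈ Set.Icc (0 : ℝ) 1 := by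
    intro i x
    by_cases hx : x i ∈ S <;> simp [Y, hx]
  have hYL : ∀ i, MemLp (Y i) 2 μ := fun i =>
    memLp_of_bounded (ae_of_all _ (hY01 i)) (hYm i).aestronglyMeasurable 2
  have hsum : (∑ i, Y i) = fun x => hitCount S x := by
    ext x; simp [Y, hitCount]
  have hvar : Var[fun x => hitCount S x; μ] ≤ n / 4 := by
    rw [← hsum, IndepFun.variance_sum (fun i _ => hYL i)]
    · calc ∑ i, Var[Y i; μ] ≤ ∑ _i : Fin n, ((1 - 0 : ℝ) / 2) ^ 2 :=
            Finset.sum_le_sum fun i _ =>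
              variance_le_sq_of_bounded (ae_of_all _ (hY01 i)) (hYm i).aemeasurable
        _ = n / 4 := by simp; ring
    · intro i _ j _ hij
      exact (iIndepFun_pi (μ := fun _ : Fin n => M) (X := fun _ => S.indicator (1 : E → ℝ))
        fun _ => hind.aemeasurable).indepFun hij
  have hmean : ∫ x, hitCount S x ∂μ = n * M.real S := by
    have h1 : ∀ i, ∫ x, Y i x ∂μ = M.real S := by
      intro i
      have h2 := (measurePreserving_eval (fun _ : Fin n => M) i)
      have h3 : ∫ x, S.indicator (1 : E → ℝ) (Function.eval i x) ∂μ
          = ∫ y, S.indicator (1 : E → ℝ) y ∂M := by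
        rw [← h2.map_eq, integral_map h2.aemeasurable hind.aestronglyMeasurable]
      rw [integral_indicator_one hS] at h3
      exact h3
    have h4 : ∀ x, hitCount S x = ∑ i, Y i x := fun x => rfl
    simp_rw [h4]
    rw [integral_finsetSum _ fun i _ => (hYL i).integrable (by norm_num)]
    simp [h1]
  have hL : MemLp (fun x => hitCount S x) 2 μ := by
    rw [← hsum]; exact memLp_finsetSum' _ fun i _ => hYL i
  have hcheb := meas_ge_le_variance_div_sq hL hs
  rw [hmean] at hcheb
  have h5 : ENNReal.ofReal (Var[fun x => hitCount S x; μ] / s ^ 2) ≤ 1 / 2 := by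
    rw [show (1 / 2 : ℝ≥0∞) = ENNReal.ofReal (1 / 2) by
      rw [ENNReal.ofReal_div_of_pos (by norm_num)]; simp]
    apply ENNReal.ofReal_le_ofReal
    rw [div_le_iff₀ (by positivity)]
    linarith
  have hm : Measurable fun x : Fin n → E => hitCount S x := by
    exact Finset.measurable_sum _ fun i _ => hYm i
  have hcompl : {x : Fin n → E | |hitCount S x - n * M.real S| ≤ s}ᶜ ⊆
      {x | s ≤ |hitCount S x - n * M.real S|} :=
    fun x hx => by
      rw [Set.mem_compl_iff, Set.mem_ofPred_eq, not_le] at hx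
      exact hx.le
  have h6 : MeasurableSet {x : Fin n → E | |hitCount S x - n * M.real S| ≤ s} :=
    measurableSet_le (hm.sub_const _).abs measurable_const
  have h7 := prob_add_prob_compl (μ := μ) h6
  have h8 := (measure_mono hcompl).trans (hcheb.trans h5)
  have h10 : (1 / 2 : ℝ≥0∞) + 1 / 2 = 1 := ENNReal.add_halves 1
  have h9 : (1 / 2 : ℝ≥0∞) + 1 / 2 ≤ μ {x | |hitCount S x - n * M.real S| ≤ s} + 1 / 2 :=
    (h10.trans h7.symm).le.trans (add_le_add_right h8 _)
  have h11 : (1 / 2 : ℝ≥0∞) ≠ ∞ := by simp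
  exact (ENNReal.add_le_add_iff_right h11).1 h9

/-- **Uniform law of large numbers** over a countable class of VC dimension at most `D`. A second,
independent sample replaces the probabilities by its frequencies at the price of a factor `2`. -/
theorem pi_exists_lt_abs_hitCount_sub_le {J : Type*} [Countable J] (h : J → Set E)
    (hmeas : ∀ j, MeasurableSet (h j)) {D : ℕ} (hD : 1 ≤ D)
    (hVC : ∀ x : Fin n → E, (traceFamily h x).vcDim ≤ D) (hn : 0 < n) {L : ℝ} (hL : 0 ≤ L) :
    (Measure.pi fun _ : Fin n => M) {x | ∃ j, 32 * √(2 * n * (6 * D + L)) <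
        |hitCount (h j) x - n * M.real (h j)|} ≤ ENNReal.ofReal (4 * Real.exp (-L)) := by
  set s := 16 * √(2 * n * (6 * D + L)) with hs_def
  have hn' : (1 : ℝ) ≤ n := by exact_mod_cast hn
  have hD' : (1 : ℝ) ≤ D := by exact_mod_cast hD
  have hs : 0 < s := by
    have : (0 : ℝ) < 2 * n * (6 * D + L) := by positivity
    positivity
  have hs2 : (n : ℝ) ≤ 2 * s ^ 2 := by
    rw [hs_def, mul_pow, Real.sq_sqrt (by positivity)]
    nlinarith
  set μ := Measure.pi fun _ : Fin n => M
  have hind : ∀ j, Measurable ((h j).indicator (1 : E → ℝ)) := fun j =>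
    measurable_one.indicator (hmeas j)
  have hhit : ∀ j, Measurable fun x : Fin n → E => hitCount (h j) x := fun j =>
    Finset.measurable_sum _ fun i _ => (hind j).comp (measurable_pi_apply i)
  let B : Set ((Fin n → E) × (Fin n → E)) :=
    {p | ∃ j, s < |hitCount (h j) p.1 - hitCount (h j) p.2|}
  have hB : MeasurableSet B := by
    simp only [B, Set.ofPred_exists]
    exact MeasurableSet.iUnion fun j => measurableSet_lt measurable_const
      (((hhit j).comp measurable_fst).sub ((hhit j).comp measurable_snd)).abs
  have h1 : (μ.prod μ) B ≤ ENNReal.ofReal (2 * Real.exp (-L)) := by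
    have hmp := measurePreserving_arrowProdEquivProdArrow E E (Fin n) (fun _ => M) (fun _ => M)
    rw [← hmp.measure_preimage hB.nullMeasurableSet]
    refine le_of_eq_of_le ?_ (pi_prod_exists_lt_abs_le M h hmeas hD hVC hn hL)
    congr 1
    ext w
    simp only [B, Set.mem_preimage, Set.mem_ofPred_eq, hitCount, ← Finset.sum_sub_distrib]
    rfl
  have h2 : {x | ∃ j, 32 * √(2 * n * (6 * D + L)) < |hitCount (h j) x - n * M.real (h j)|} ⊆
      {x | 1 / 2 ≤ μ (Prod.mk x ⁻¹' B)} := by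
    rintro x ⟨j, hj⟩
    refine (half_le_pi_abs_hitCount_sub_le M (hmeas j) hs hs2).trans (measure_mono fun y hy => ?_)
    refine ⟨j, ?_⟩
    have hy' : |hitCount (h j) y - n * M.real (h j)| ≤ s := hy
    have h3 := abs_sub_le (hitCount (h j) x) (hitCount (h j) y) (n * M.real (h j))
    simp only
    linarith
  have h3 := mul_meas_ge_le_lintegral (measurable_measure_prodMk_left (ν := μ) hB) (1 / 2) (μ := μ)
  rw [← Measure.prod_apply hB] at h3
  have h4 := (mul_le_mul_right (measure_mono (μ := μ) h2) (1 / 2)).trans (h3.trans h1)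
  calc μ {x | ∃ j, 32 * √(2 * n * (6 * D + L)) < |hitCount (h j) x - n * M.real (h j)|}
      = 2 * (1 / 2 * μ {x | ∃ j, 32 * √(2 * n * (6 * D + L)) <
          |hitCount (h j) x - n * M.real (h j)|}) := by
        rw [← mul_assoc, one_div, ENNReal.mul_inv_cancel (by simp) (by simp), one_mul]
    _ ≤ 2 * ENNReal.ofReal (2 * Real.exp (-L)) := by gcongr
    _ = _ := by
        rw [show (2 : ℝ≥0∞) = ENNReal.ofReal 2 by simp, ← ENNReal.ofReal_mul (by norm_num)]
        congr 1; ring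

end UniformDeviation

/-! ### Halfspaces and empirical laws -/

section Halfspaces

/-- Halfspaces of `ℝ^d` have VC dimension at most `d + 1`: a shattered set of more points would contradict
Radon's theorem, since the two parts of a Radon partition cannot be separated. -/
lemma vcDim_traceFamily_halfspace_le {d n : ℕ} {J : Type*} (u : J → EuclideanSpace ℝ (Fin d))
    (c : J → ℝ) (x : Fin n → EuclideanSpace ℝ (Fin d)) :
    (traceFamily (fun j => {y | ⟪y, u j⟫ ≤ c j}) x).vcDim ≤ d + 1 := by
  classical
  refine Finset.sup_le fun T hT => ?_
  rw [Finset.mem_shatterer] at hT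
  by_contra! hcard
  let f : T → EuclideanSpace ℝ (Fin d) := fun i => x i
  have hnot : ¬ AffineIndependent ℝ f := by
    intro hf
    have h1 := hf.card_le_finrank_succ
    have h2 := Submodule.finrank_le (vectorSpan ℝ (Set.range f))
    rw [finrank_euclideanSpace_fin] at h2
    rw [Fintype.card_coe] at h1
    omega
  obtain ⟨I, p, hp1, hp2⟩ := Convex.radon_partition hnot
  obtain ⟨A, hA, hTA⟩ := hT (t := T.filter fun i => ∃ h : i ∈ T, (⟨i, h⟩ : T) ∈ I)
    (Finset.filter_subset _ _)
  obtain ⟨j, rfl⟩ := (Finset.mem_filter.1 hA).2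
  have hI : ∀ i : T, i ∈ I ↔ ⟪f i, u j⟫ ≤ c j := by
    intro i
    have h1 := Finset.ext_iff.1 hTA i
    simp only [Finset.mem_inter, Finset.mem_filter, Finset.mem_univ, true_and, i.2,
      Set.mem_ofPred_eq, exists_true_left, Subtype.coe_eta] at h1
    exact h1.symm
  have hlin : IsLinearMap ℝ fun y : EuclideanSpace ℝ (Fin d) => ⟪y, u j⟫ :=
    ⟨fun a b => inner_add_left _ _ _, fun r a => by simp [real_inner_smul_left]⟩
  have h1 : ⟪p, u j⟫ ≤ c j :=
    convexHull_min (by rintro _ ⟨i, hi, rfl⟩; exact (hI i).1 hi)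
      (convex_halfSpace_le hlin (c j)) hp1
  have h2 : c j < ⟪p, u j⟫ :=
    convexHull_min (by rintro _ ⟨i, hi, rfl⟩; exact not_le.1 fun h => hi ((hI i).2 h))
      (convex_halfSpace_gt hlin (c j)) hp2
  exact absurd h1 (not_le.2 h2)

lemma measurableSet_halfspace {d : ℕ} (u : EuclideanSpace ℝ (Fin d)) (c : ℝ) :
    MeasurableSet {y : EuclideanSpace ℝ (Fin d) | ⟪y, u⟫ ≤ c} :=
  measurableSet_le (by fun_prop) measurable_const

/-- Every closed halfspace is a pointwise limit of halfspaces with normals in a dense sequence and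
rational offsets, so a uniform bound over the latter extends to all halfspaces. -/
lemma abs_measureReal_halfspace_sub_le {d : ℕ} (μ ν : Measure (EuclideanSpace ℝ (Fin d)))
    [IsFiniteMeasure μ] [IsFiniteMeasure ν] {η : ℝ}
    (h : ∀ j : ℕ × ℚ,
      |μ.real {y | ⟪y, TopologicalSpace.denseSeq (EuclideanSpace ℝ (Fin d)) j.1⟫ ≤ (j.2 : ℝ)} -
        ν.real {y | ⟪y, TopologicalSpace.denseSeq (EuclideanSpace ℝ (Fin d)) j.1⟫ ≤ (j.2 : ℝ)}| ≤ η)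
    (u : EuclideanSpace ℝ (Fin d)) (c : ℝ) :
    |μ.real {y | ⟪y, u⟫ ≤ c} - ν.real {y | ⟪y, u⟫ ≤ c}| ≤ η := by
  have hpos : ∀ k : ℕ, (0 : ℝ) < 1 / ((k : ℝ) + 1) := fun k => by positivity
  have hu : ∀ k : ℕ, ∃ m, dist u (TopologicalSpace.denseSeq (EuclideanSpace ℝ (Fin d)) m)
      < (1 / ((k : ℝ) + 1)) ^ 2 := fun k =>
    (TopologicalSpace.denseRange_denseSeq _).exists_dist_lt u (pow_pos (hpos k) 2)
  have hc : ∀ k : ℕ, ∃ q : ℚ, c + 1 / ((k : ℝ) + 1) < q ∧ (q : ℝ) < c + 2 * (1 / ((k : ℝ) + 1)) :=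
    fun k => exists_rat_btwn (by linarith [hpos k])
  choose m hm using hu
  choose q hq1 hq2 using hc
  set v : ℕ → EuclideanSpace ℝ (Fin d) := fun k => TopologicalSpace.denseSeq _ (m k)
  have hlim0 : Filter.Tendsto (fun k : ℕ => 1 / ((k : ℝ) + 1)) Filter.atTop (nhds 0) :=
    tendsto_one_div_add_atTop_nhds_zero_nat
  have hdiff : ∀ y k, |⟪y, v k⟫ - ⟪y, u⟫| ≤ ‖y‖ * (1 / ((k : ℝ) + 1)) ^ 2 := by
    intro y k
    rw [← inner_sub_right]
    refine (abs_real_inner_le_norm _ _).trans ?_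
    have := hm k
    rw [dist_comm, dist_eq_norm] at this
    gcongr
  have hlim : ∀ y, ∀ᶠ k in Filter.atTop, y ∈ {y | ⟪y, v k⟫ ≤ (q k : ℝ)} ↔ y ∈ {y | ⟪y, u⟫ ≤ c} := by
    intro y
    -- The offset exceeds `c` by `1 / (k + 1)`, which dominates the error `‖y‖ / (k + 1) ^ 2`.
    by_cases hy : ⟪y, u⟫ ≤ c
    · filter_upwards [Filter.eventually_ge_atTop ⌈‖y‖⌉₊] with k hk
      refine iff_of_true ?_ hy
      have h1 : ‖y‖ ≤ k := (Nat.le_ceil _).trans (by exact_mod_cast hk)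
      have h2 : ‖y‖ * (1 / ((k : ℝ) + 1)) ≤ 1 := by
        rw [mul_one_div, div_le_one (by positivity)]; linarith
      have h3 := (abs_le.1 (hdiff y k)).2
      have h4 : ‖y‖ * (1 / ((k : ℝ) + 1)) ^ 2 ≤ 1 / ((k : ℝ) + 1) := by
        rw [sq, ← mul_assoc]; exact mul_le_of_le_one_left (hpos k).le h2
      have h5 := hq1 k
      show ⟪y, v k⟫ ≤ (q k : ℝ)
      linarith
    · have hlim1 : Filter.Tendsto (fun k : ℕ => c + 2 * (1 / ((k : ℝ) + 1)) +
          ‖y‖ * (1 / ((k : ℝ) + 1)) ^ 2) Filter.atTop (nhds (c + 2 * 0 + ‖y‖ * 0 ^ 2)) :=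
        ((hlim0.const_mul 2).const_add c).add ((hlim0.pow 2).const_mul _)
      have hlt : c + 2 * 0 + ‖y‖ * 0 ^ 2 < ⟪y, u⟫ := by
        have := not_le.1 hy; linarith
      filter_upwards [hlim1.eventually_lt_const hlt] with k hk
      refine iff_of_false ?_ hy
      have h3 := (abs_le.1 (hdiff y k)).1
      have h5 := hq2 k
      show ¬ ⟪y, v k⟫ ≤ (q k : ℝ)
      linarith
  have hconv : ∀ (ρ : Measure (EuclideanSpace ℝ (Fin d))) [IsFiniteMeasure ρ],
      Filter.Tendsto (fun k => ρ.real {y | ⟪y, v k⟫ ≤ (q k : ℝ)}) Filter.atTop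
        (nhds (ρ.real {y | ⟪y, u⟫ ≤ c})) := by
    intro ρ _
    exact (ENNReal.tendsto_toReal (measure_ne_top _ _)).comp
      (tendsto_measure_of_tendsto_indicator_of_isFiniteMeasure Filter.atTop ρ
        (fun k => measurableSet_halfspace _ _) hlim)
  exact le_of_tendsto ((hconv μ).sub (hconv ν)).abs
    (Filter.Eventually.of_forall fun k => h (m k, q k))

lemma empiricalLaw_real_eq {d n : ℕ} (x : Fin n → EuclideanSpace ℝ (Fin d))
    {S : Set (EuclideanSpace ℝ (Fin d))} (hS : MeasurableSet S) :
    (empiricalLaw x).real S = hitCount S x / n := by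
  have h1 : (empiricalLaw x) S = (n : ℝ≥0∞)⁻¹ * ∑ i, S.indicator 1 (x i) := by
    simp [empiricalLaw, Measure.dirac_apply' _ hS]
  rw [Measure.real, h1, ENNReal.toReal_mul, ENNReal.toReal_sum, hitCount, div_eq_inv_mul]
  · congr 1
    · simp
    · refine Finset.sum_congr rfl fun i _ => ?_
      by_cases hi : x i ∈ S <;> simp [hi]
  · intro i _
    by_cases hi : x i ∈ S <;> simp [hi]

lemma isProbabilityMeasure_empiricalLaw {d n : ℕ} (hn : 0 < n)
    (x : Fin n → EuclideanSpace ℝ (Fin d)) : IsProbabilityMeasure (empiricalLaw x) := by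
  constructor
  simp only [empiricalLaw, Measure.smul_apply, Measure.finsetSum_apply, measure_univ,
    Finset.sum_const, Finset.card_univ, Fintype.card_fin, nsmul_eq_mul, mul_one, smul_eq_mul]
  exact ENNReal.inv_mul_cancel (by exact_mod_cast hn.ne') (by simp)

/-- The empirical law is uniformly close to the underlying law on all closed halfspaces, with the optimal
rate `√(d / n)` and sub-Gaussian confidence. The exceptional event is covered by a measurable one. -/
theorem exists_measurableSet_halfspace_deviation {d n : ℕ} (hd : 1 ≤ d) (hn : 0 < n)
    (M : Measure (EuclideanSpace ℝ (Fin d))) [IsProbabilityMeasure M] {δ : ℝ} (hδ : 0 < δ)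
    (hδ2 : δ < 1 / 2) :
    ∃ B : Set (Fin n → EuclideanSpace ℝ (Fin d)), MeasurableSet B ∧
      (Measure.pi fun _ : Fin n => M) B ≤ ENNReal.ofReal (2 * δ) ∧
      ∀ x ∉ B, ∀ u c, |(empiricalLaw x).real {y | ⟪y, u⟫ ≤ c} - M.real {y | ⟪y, u⟫ ≤ c}| ≤
        160 * √(d / n) + 64 * √(Real.log (1 / δ) / n) := by
  set v := TopologicalSpace.denseSeq (EuclideanSpace ℝ (Fin d))
  let H : ℕ × ℚ → Set (EuclideanSpace ℝ (Fin d)) := fun j => {y | ⟪y, v j.1⟫ ≤ (j.2 : ℝ)}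
  have hH : ∀ j, MeasurableSet (H j) := fun j => measurableSet_halfspace _ _
  -- The failure probability `4 exp (-L)` of the uniform law has to be `2 δ`.
  set L := Real.log (2 / δ) with hL_def
  set l := Real.log (1 / δ) with hl_def
  have hl2 : Real.log 2 ≤ l := Real.log_le_log (by norm_num) (by
    rw [le_div_iff₀ hδ]; linarith)
  have hlog2 : 0 < Real.log 2 := Real.log_pos (by norm_num)
  have hL2 : L ≤ 2 * l := by
    have : L = Real.log 2 + l := by
      rw [hL_def, hl_def, ← Real.log_mul (by norm_num) (by positivity)]; congr 1; ring
    linarith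
  have hL0 : 0 ≤ L := Real.log_nonneg (by rw [le_div_iff₀ hδ]; linarith)
  have hn' : (0 : ℝ) < n := by exact_mod_cast hn
  have hd' : (1 : ℝ) ≤ d := by exact_mod_cast hd
  set τ := 32 * √(2 * n * (6 * (d + 1 : ℕ) + L)) with hτ
  refine ⟨{x | ∃ j, τ < |hitCount (H j) x - n * M.real (H j)|}, ?_, ?_, ?_⟩
  · simp only [Set.ofPred_exists]
    refine MeasurableSet.iUnion fun j => measurableSet_lt measurable_const
      (Measurable.abs (Measurable.sub_const ?_ _))
    exact Finset.measurable_sum _ fun i _ =>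
      (measurable_one.indicator (hH j)).comp (measurable_pi_apply i)
  · refine (pi_exists_lt_abs_hitCount_sub_le M H hH (D := d + 1) (by omega)
      (fun x => vcDim_traceFamily_halfspace_le _ _ x) hn hL0).trans (le_of_eq ?_)
    congr 1
    rw [hL_def, ← Real.log_inv, Real.exp_log (by positivity)]
    field_simp; norm_num
  · intro x hx u c
    have := isProbabilityMeasure_empiricalLaw hn x
    refine abs_measureReal_halfspace_sub_le _ _ (fun j => ?_) u c
    rw [Set.mem_ofPred_eq, not_exists] at hx
    have h1 : |hitCount (H j) x - n * M.real (H j)| ≤ τ := not_lt.1 (hx j)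
    change |(empiricalLaw x).real (H j) - M.real (H j)| ≤ _
    rw [empiricalLaw_real_eq x (hH j)]
    have h2 : hitCount (H j) x / n - M.real (H j) = (hitCount (H j) x - n * M.real (H j)) / n := by
      field_simp
    rw [h2, abs_div, abs_of_pos hn', div_le_iff₀ hn']
    refine h1.trans ?_
    have h3 : √(2 * n * (6 * (d + 1 : ℕ) + L)) ≤ (5 * √(d / n) + 2 * √(l / n)) * n := by
      apply Real.sqrt_le_iff.2
      have ha := Real.sqrt_nonneg ((d : ℝ) / n)
      have hb := Real.sqrt_nonneg (l / n)
      have ha2 : √((d : ℝ) / n) ^ 2 = d / n := Real.sq_sqrt (by positivity)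
      have hb2 : √(l / n) ^ 2 = l / n := Real.sq_sqrt (by
        have : 0 ≤ l := by linarith
        positivity)
      refine ⟨by positivity, ?_⟩
      have h4 : 2 * n * (6 * ((d + 1 : ℕ) : ℝ) + L) ≤ n * (25 * d + 4 * l) := by
        push_cast
        nlinarith
      have h5 : (n : ℝ) * (25 * d + 4 * l) = (25 * (d / n) + 4 * (l / n)) * n ^ 2 := by
        field_simp
      rw [mul_pow]
      refine h4.trans (h5.le.trans ?_)
      gcongr
      have h6 : (5 * √((d : ℝ) / n) + 2 * √(l / n)) ^ 2
          = 25 * √((d : ℝ) / n) ^ 2 + 4 * √(l / n) ^ 2 + 20 * (√((d : ℝ) / n) * √(l / n)) := by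
        ring
      rw [h6, ha2, hb2]
      linarith [mul_nonneg ha hb]
    rw [hτ]
    linarith

end Halfspaces

/-! ### The α-norm, its dual, and barycenters -/

section AlphaNorm

variable {d : ℕ}

lemma pNorm_ofReal_eq {α : ℝ} (hα : 0 < α) (x : EuclideanSpace ℝ (Fin d)) :
    pNorm (ENNReal.ofReal α) x = (∑ i, |x i| ^ α) ^ (1 / α) := by
  have h : (ENNReal.ofReal α).toReal = α := ENNReal.toReal_ofReal hα.le
  rw [pNorm, PiLp.norm_eq_sum (by rwa [h]), h]
  rfl

lemma pNorm_ofReal_nonneg {α : ℝ} (hα : 0 < α) (x : EuclideanSpace ℝ (Fin d)) :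
    0 ≤ pNorm (ENNReal.ofReal α) x := by
  rw [pNorm_ofReal_eq hα]; positivity

lemma pNorm_ofReal_pos {α : ℝ} (hα : 0 < α) {x : EuclideanSpace ℝ (Fin d)} (hx : x ≠ 0) :
    0 < pNorm (ENNReal.ofReal α) x := by
  rw [pNorm_ofReal_eq hα]
  obtain ⟨i, hi⟩ : ∃ i, x i ≠ 0 := by
    by_contra! h
    exact hx (by ext i; simpa using h i)
  have : 0 < ∑ i, |x i| ^ α := Finset.sum_pos' (fun j _ => by positivity)
    ⟨i, Finset.mem_univ i, Real.rpow_pos_of_pos (abs_pos.2 hi) _⟩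
  positivity

lemma pNorm_ofReal_smul {α : ℝ} (hα : 0 < α) (s : ℝ) (x : EuclideanSpace ℝ (Fin d)) :
    pNorm (ENNReal.ofReal α) (s • x) = |s| * pNorm (ENNReal.ofReal α) x := by
  rw [pNorm_ofReal_eq hα, pNorm_ofReal_eq hα]
  have h1 : ∑ i, |(s • x) i| ^ α = |s| ^ α * ∑ i, |x i| ^ α := by
    rw [Finset.mul_sum]
    refine Finset.sum_congr rfl fun i _ => ?_
    rw [PiLp.smul_apply, smul_eq_mul, abs_mul, Real.mul_rpow (abs_nonneg _) (abs_nonneg _)]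
  rw [h1, Real.mul_rpow (by positivity) (by positivity), one_div,
    Real.rpow_rpow_inv (abs_nonneg _) hα.ne']

lemma pNorm_ofReal_single {α : ℝ} (hα : 0 < α) (i : Fin d) :
    pNorm (ENNReal.ofReal α) (EuclideanSpace.single i (1 : ℝ)) = 1 := by
  rw [pNorm_ofReal_eq hα, Finset.sum_eq_single i]
  · simp
  · intro j _ hj; simp [hj, hα.ne']
  · simp

/-- The norm with conjugate index is dominated by the support functional of the unit ball of `‖·‖_α`.
For `α ≤ 1` the coordinate directions suffice, for `α > 1` this is Hölder duality. -/
lemma pNorm_conjIndex_le {α : ℝ} (hα : 0 < α) {R : ℝ} (hR : 0 ≤ R)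
    {x : EuclideanSpace ℝ (Fin d)}
    (h : ∀ u : EuclideanSpace ℝ (Fin d), |⟪x, u⟫| ≤ R * pNorm (ENNReal.ofReal α) u) :
    pNorm (conjIndex α) x ≤ R := by
  rw [conjIndex]
  split_ifs with h1
  · have hconj : (α / (α - 1)).HolderConjugate α := (Real.HolderConjugate.conjExponent h1).symm
    rw [pNorm_ofReal_eq hconj.pos]
    obtain ⟨⟨g, hg, hgx⟩, -⟩ :=
      NNReal.isGreatest_Lp Finset.univ (fun i => Real.nnabs (x i)) hconj
    let u : EuclideanSpace ℝ (Fin d) := WithLp.toLp 2 fun i => SignType.sign (x i) * (g i : ℝ)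
    have hxu : ⟪x, u⟫ = (∑ i, |x i| ^ (α / (α - 1))) ^ (1 / (α / (α - 1))) := by
      have h2 := congrArg (fun r : NNReal => (r : ℝ)) hgx
      simp only [NNReal.coe_sum, NNReal.coe_mul, Real.coe_nnabs, NNReal.coe_rpow] at h2
      rw [← h2, PiLp.inner_apply]
      refine Finset.sum_congr rfl fun i _ => ?_
      have h3 := self_mul_sign (x i)
      simp only [u, RCLike.inner_apply, conj_trivial]
      rw [← h3]; ring
    have hu : pNorm (ENNReal.ofReal α) u ≤ 1 := by
      rw [pNorm_ofReal_eq hα]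
      refine Real.rpow_le_one (by positivity) ?_ (by positivity)
      have h4 : ((∑ i, g i ^ α : NNReal) : ℝ) ≤ 1 := by exact_mod_cast hg
      push_cast at h4
      refine (Finset.sum_le_sum fun i _ => ?_).trans h4
      refine Real.rpow_le_rpow (abs_nonneg _) ?_ hα.le
      simp only [u, abs_mul, NNReal.abs_eq]
      refine mul_le_of_le_one_left (g i).2 ?_
      rcases lt_trichotomy (x i) 0 with h5 | h5 | h5 <;> simp [h5]
    rw [← hxu]
    exact (le_abs_self _).trans ((h u).trans (mul_le_of_le_one_right hR hu))
  · rw [pNorm, PiLp.norm_eq_ciSup]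
    refine Real.iSup_le (fun i => ?_) hR
    have h2 := h (EuclideanSpace.single i 1)
    rw [pNorm_ofReal_single hα, mul_one, EuclideanSpace.inner_single_right] at h2
    simpa using h2

/-- The average of a set over its Hausdorff measure lies in every bounded closed convex set that contains
the set and the origin. The origin is included because an average with respect to a null or infinite
measure is `0` by convention. -/
lemma barycenter_mem {S C : Set (EuclideanSpace ℝ (Fin d))} (hC : Convex ℝ C) (hcl : IsClosed C)
    (hb : Bornology.IsBounded C) (h0 : 0 ∈ C) (hS : S ⊆ C) : barycenter S ∈ C := by
  rw [barycenter]
  set μ : Measure (EuclideanSpace ℝ (Fin d)) :=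
    Measure.hausdorffMeasure (Module.finrank ℝ (vectorSpan ℝ S) : ℝ)
  by_cases hz : μ S = 0
  · rw [setAverage_eq, Measure.real, hz]; simpa using h0
  by_cases ht : μ S = ∞
  · rw [setAverage_eq, Measure.real, ht]; simpa using h0
  have hae : ∀ᵐ x ∂μ.restrict S, x ∈ C := by
    rw [ae_restrict_iff (p := fun x => x ∈ C) hcl.measurableSet]
    exact ae_of_all _ fun x hx => hS hx
  refine hC.set_average_mem hcl hz ht hae ?_
  obtain ⟨K, hK⟩ := hb.exists_norm_le
  refine Measure.integrableOn_of_bounded ht measurable_id.aestronglyMeasurable (M := K) ?_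
  filter_upwards [hae] with x hx using hK x hx

/-- The polar set `{z | |⟨z, u⟩| ≤ R ‖u‖_α for all u}` is an intersection of slabs, hence closed and convex
also when `‖·‖_α` is not a norm, and it is stable under barycenters. -/
lemma abs_inner_barycenter_le {α : ℝ} (hα : 0 < α) {R : ℝ} (hR : 0 ≤ R)
    {S : Set (EuclideanSpace ℝ (Fin d))}
    (h : ∀ x ∈ S, ∀ u, |⟪x, u⟫| ≤ R * pNorm (ENNReal.ofReal α) u) :
    ∀ u, |⟪barycenter S, u⟫| ≤ R * pNorm (ENNReal.ofReal α) u := by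
  have hC : {z : EuclideanSpace ℝ (Fin d) | ∀ u, |⟪z, u⟫| ≤ R * pNorm (ENNReal.ofReal α) u}
      = ⋂ u, {z | |⟪z, u⟫| ≤ R * pNorm (ENNReal.ofReal α) u} := by
    ext z; simp
  have := barycenter_mem (S := S)
    (C := {z | ∀ u, |⟪z, u⟫| ≤ R * pNorm (ENNReal.ofReal α) u}) ?_ ?_ ?_ ?_ h
  · exact this
  · rw [hC]
    refine convex_iInter fun u => ?_
    have hlin : IsLinearMap ℝ fun y : EuclideanSpace ℝ (Fin d) => ⟪y, u⟫ :=
      ⟨fun a b => inner_add_left _ _ _, fun r a => by simp [real_inner_smul_left]⟩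
    simp_rw [abs_le, Set.ofPred_and]
    exact (convex_halfSpace_ge hlin _).inter (convex_halfSpace_le hlin _)
  · rw [hC]
    exact isClosed_iInter fun u => isClosed_le (by fun_prop) continuous_const
  · refine isBounded_iff_forall_norm_le.2 ⟨√(∑ _i : Fin d, R ^ 2), fun z hz => ?_⟩
    rw [EuclideanSpace.norm_eq]
    refine Real.sqrt_le_sqrt (Finset.sum_le_sum fun i _ => ?_)
    have h2 := hz (EuclideanSpace.single i 1)
    rw [pNorm_ofReal_single hα, mul_one, EuclideanSpace.inner_single_right] at h2
    have h3 : ‖z i‖ ≤ R := by simpa using h2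
    gcongr
  · intro u
    simpa using mul_nonneg hR (pNorm_ofReal_nonneg hα u)

end AlphaNorm

/-! ### Depth and medians under α-symmetry and contamination -/

section AlphaSymmetric

variable {d : ℕ} {P : Measure (EuclideanSpace ℝ (Fin d))} [IsProbabilityMeasure P]

/-- Under an `α`-symmetric law, `⟨X, u⟩` is distributed like `‖u‖_α X_i`: both have the characteristic
function `s ↦ φ (|s| ‖u‖_α)`. -/
lemma IsAlphaSymmetric.map_inner_eq {α : ℝ} (hα : 0 < α) (hP : IsAlphaSymmetric α P) (i : Fin d)
    (u : EuclideanSpace ℝ (Fin d)) :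
    P.map (fun y => ⟪y, u⟫) = P.map (fun y => pNorm (ENNReal.ofReal α) u * y i) := by
  obtain ⟨φ, -, hφ⟩ := hP
  set a := pNorm (ENNReal.ofReal α) u
  have ha : 0 ≤ a := pNorm_ofReal_nonneg hα u
  have hmap : ∀ w : EuclideanSpace ℝ (Fin d), ∀ s : ℝ,
      charFun (P.map fun y => ⟪y, w⟫) s = charFun P (s • w) := by
    intro w s
    rw [charFun_apply, charFun_apply, integral_map (by fun_prop)
      (by fun_prop)]
    refine integral_congr_ae (ae_of_all _ fun y => ?_)
    simp [real_inner_smul_right]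
  have hcoord : (fun y : EuclideanSpace ℝ (Fin d) => a * y i)
      = fun y => ⟪y, a • EuclideanSpace.single i (1 : ℝ)⟫ := by
    ext y; simp [real_inner_smul_right, EuclideanSpace.inner_single_right]
  have h1 : IsProbabilityMeasure (P.map fun y => ⟪y, u⟫) :=
    Measure.isProbabilityMeasure_map (by fun_prop)
  have h2 : IsProbabilityMeasure
      (P.map fun y => ⟪y, a • EuclideanSpace.single i (1 : ℝ)⟫) :=
    Measure.isProbabilityMeasure_map (by fun_prop)
  rw [hcoord]
  refine Measure.ext_of_charFun (funext fun s => ?_)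
  rw [hmap, hmap, hφ, hφ, pNorm_ofReal_smul hα, pNorm_ofReal_smul hα, pNorm_ofReal_smul hα,
    pNorm_ofReal_single hα, mul_one, abs_of_nonneg ha]

lemma IsAlphaSymmetric.real_halfspace_eq {α : ℝ} (hα : 0 < α) (hP : IsAlphaSymmetric α P)
    (i : Fin d) {u : EuclideanSpace ℝ (Fin d)} (hu : u ≠ 0) (c : ℝ) :
    P.real {y | ⟪y, u⟫ ≤ c} = marginalCDF P i (c / pNorm (ENNReal.ofReal α) u) := by
  have ha := pNorm_ofReal_pos hα hu
  have h1 := congrArg (fun μ : Measure ℝ => μ.real (Set.Iic c)) (hP.map_inner_eq hα i u)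
  simp only at h1
  rw [map_measureReal_apply (by fun_prop) measurableSet_Iic,
    map_measureReal_apply (by fun_prop) measurableSet_Iic] at h1
  rw [marginalCDF]
  refine Eq.trans ?_ (h1.trans ?_)
  · rfl
  · congr 1
    ext y
    simp only [Set.mem_preimage, Set.mem_Iic, Set.mem_ofPred_eq]
    rw [le_div_iff₀ ha, mul_comm]

lemma marginalCDF_mono (i : Fin d) : Monotone (marginalCDF P i) := fun _ _ hst =>
  measureReal_mono fun _ hy => le_trans hy hst

lemma GrowthCondition.marginalCDF_neg_le {γ κ : ℝ} {i : Fin d}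
    (h : GrowthCondition γ κ (marginalCDF P i)) {t : ℝ} (ht : 0 < t) (htγ : t < γ) :
    marginalCDF P i (-t) ≤ marginalCDF P i 0 - κ * t := by
  have h1 := h (-t) (by simpa using ht.ne') (by simpa [abs_of_pos ht] using htγ)
  have h2 := marginalCDF_mono (P := P) i (show -t ≤ 0 by linarith)
  rw [abs_neg, abs_of_pos ht, le_div_iff₀ ht, abs_of_nonpos (by linarith)] at h1
  linarith

lemma halfspaceDepth_le (ν : Measure (EuclideanSpace ℝ (Fin d)))
    (x : EuclideanSpace ℝ (Fin d)) {u : EuclideanSpace ℝ (Fin d)} (hu : u ≠ 0) :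
    halfspaceDepth x ν ≤ ν.real {y | ⟪y, u⟫ ≤ ⟪x, u⟫} := by
  have hpos : 0 < ‖u‖⁻¹ := inv_pos.2 (norm_pos_iff.2 hu)
  have h1 : {y : EuclideanSpace ℝ (Fin d) | ⟪y, u⟫ ≤ ⟪x, u⟫}
      = {y | ⟪y, ‖u‖⁻¹ • u⟫ ≤ ⟪x, ‖u‖⁻¹ • u⟫} := by
    ext y
    simp only [Set.mem_ofPred_eq, real_inner_smul_right]
    rw [mul_le_mul_iff_right₀ hpos]
  rw [h1]
  refine ciInf_le ⟨0, ?_⟩ (⟨‖u‖⁻¹ • u, ?_⟩ : Metric.sphere (0 : EuclideanSpace ℝ (Fin d)) 1)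
  · rintro _ ⟨v, rfl⟩; exact measureReal_nonneg
  · rw [mem_sphere_zero_iff_norm, norm_smul, norm_inv, norm_norm,
      inv_mul_cancel₀ (norm_ne_zero_iff.2 hu)]

lemma le_halfspaceDepth_zero (i : Fin d) (ν : Measure (EuclideanSpace ℝ (Fin d))) {b : ℝ}
    (h : ∀ u ≠ 0, b ≤ ν.real {y | ⟪y, u⟫ ≤ 0}) : b ≤ halfspaceDepth 0 ν := by
  have : Nonempty (Metric.sphere (0 : EuclideanSpace ℝ (Fin d)) 1) :=
    ⟨⟨EuclideanSpace.single i 1, by simp⟩⟩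
  refine le_ciInf fun u => ?_
  have hu : (u : EuclideanSpace ℝ (Fin d)) ≠ 0 := by
    intro h0
    have := u.2
    rw [h0] at this; simp at this
  simpa using h u hu

/-- An `α`-symmetric law whose marginals grow near `0` has the origin as its only point of maximal
depth. -/
lemma IsAlphaSymmetric.medianSet_subset {α γ κ : ℝ} (hα : 0 < α) (hP : IsAlphaSymmetric α P)
    (hγ : 0 < γ) (hκ : 0 < κ) (i : Fin d) (hG : GrowthCondition γ κ (marginalCDF P i)) :
    medianSet P ⊆ {0} := by
  intro x hx
  by_contra hx0
  have hx0 : x ≠ 0 := hx0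
  have h0 : marginalCDF P i 0 ≤ halfspaceDepth 0 P := le_halfspaceDepth_zero i P fun u hu => by
    rw [hP.real_halfspace_eq hα i hu, zero_div]
  have hnx : -x ≠ 0 := neg_ne_zero.2 hx0
  have h1 := halfspaceDepth_le P x hnx
  rw [hP.real_halfspace_eq hα i hnx, inner_neg_right, real_inner_self_eq_norm_sq, neg_div] at h1
  have ha := pNorm_ofReal_pos hα hnx
  set r := ‖x‖ ^ 2 / pNorm (ENNReal.ofReal α) (-x)
  have hr : 0 < r := by
    have := norm_pos_iff.2 hx0
    positivity
  set t := min r (γ / 2)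
  have ht : 0 < t := lt_min hr (by linarith)
  have htγ : t < γ := (min_le_right _ _).trans_lt (by linarith)
  have h2 := hG.marginalCDF_neg_le ht htγ
  have h3 := marginalCDF_mono (P := P) i (neg_le_neg (min_le_left r (γ / 2)))
  have h4 := hx 0
  have h5 := mul_pos hκ ht
  linarith

lemma IsAlphaSymmetric.halfspaceMedian_eq_zero {α γ κ : ℝ} (hα : 0 < α)
    (hP : IsAlphaSymmetric α P) (hγ : 0 < γ) (hκ : 0 < κ) (i : Fin d)
    (hG : GrowthCondition γ κ (marginalCDF P i)) : halfspaceMedian P = 0 :=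
  barycenter_mem (convex_singleton 0) isClosed_singleton Bornology.isBounded_singleton rfl
    (hP.medianSet_subset hα hγ hκ i hG)

variable {Q : Measure (EuclideanSpace ℝ (Fin d))} [IsProbabilityMeasure Q]

lemma contaminated_real {ε : ℝ} (hε : 0 ≤ ε) (hε1 : ε ≤ 1) (S : Set (EuclideanSpace ℝ (Fin d))) :
    (contaminated ε P Q).real S = (1 - ε) * P.real S + ε * Q.real S := by
  have h1 : ENNReal.ofReal (1 - ε) * P S ≠ ∞ := ENNReal.mul_ne_top (by simp) (measure_ne_top _ _)
  have h2 : ENNReal.ofReal ε * Q S ≠ ∞ := ENNReal.mul_ne_top (by simp) (measure_ne_top _ _)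
  rw [contaminated, Measure.real, Measure.add_apply, Measure.smul_apply, Measure.smul_apply,
    smul_eq_mul, smul_eq_mul, ENNReal.toReal_add h1 h2, ENNReal.toReal_mul, ENNReal.toReal_mul,
    ENNReal.toReal_ofReal (by linarith), ENNReal.toReal_ofReal hε, Measure.real, Measure.real]

lemma isProbabilityMeasure_contaminated {ε : ℝ} (hε : 0 ≤ ε) (hε1 : ε ≤ 1) :
    IsProbabilityMeasure (contaminated ε P Q) := by
  constructor
  simp only [contaminated, Measure.add_apply, Measure.smul_apply, measure_univ, smul_eq_mul,
    mul_one]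
  rw [← ENNReal.ofReal_add (by linarith) hε]; simp

/-- If a law `ν` agrees with the contaminated law up to `η` on all halfspaces, then its deepest points are
close to the origin in every direction. Indeed the depth of the origin is at least `(1 - ε) F 0 - η`,
while that of `x` is at most `(1 - ε) F (⟨x, u⟩ / ‖u‖_α) + ε + η`. -/
lemma IsAlphaSymmetric.abs_inner_medianSet_le {α γ κ ε η : ℝ} (hα : 0 < α)
    (hP : IsAlphaSymmetric α P) (hγ : 0 < γ) (hκ : 0 < κ) (i : Fin d)
    (hG : GrowthCondition γ κ (marginalCDF P i)) (hε : 0 < ε) (hε3 : ε < 1 / 3) (hη : 0 ≤ η)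
    (hsmall : 3 * η < γ * κ - ε / (1 - ε)) {ν : Measure (EuclideanSpace ℝ (Fin d))}
    (hν : ∀ u c, |ν.real {y | ⟪y, u⟫ ≤ c} - (contaminated ε P Q).real {y | ⟪y, u⟫ ≤ c}| ≤ η)
    {x : EuclideanSpace ℝ (Fin d)} (hx : x ∈ medianSet ν) (u : EuclideanSpace ℝ (Fin d)) :
    |⟪x, u⟫| ≤ (3 / 2 * ε + 3 * η) / κ * pNorm (ENNReal.ofReal α) u := by
  have hε1 : 0 < 1 - ε := by linarith
  have hdepth0 : (1 - ε) * marginalCDF P i 0 - η ≤ halfspaceDepth 0 ν := by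
    refine le_halfspaceDepth_zero i ν fun u hu => ?_
    have h1 := (abs_le.1 (hν u 0)).1
    rw [contaminated_real hε.le (by linarith), hP.real_halfspace_eq hα i hu, zero_div] at h1
    have h2 := mul_nonneg hε.le (measureReal_nonneg (μ := Q) (s := {y | ⟪y, u⟫ ≤ 0}))
    linarith
  have key : ∀ u : EuclideanSpace ℝ (Fin d),
      -⟪x, u⟫ ≤ (3 / 2 * ε + 3 * η) / κ * pNorm (ENNReal.ofReal α) u := by
    intro u
    rcases eq_or_ne u 0 with rfl | hu
    · have := mul_nonneg (show 0 ≤ (3 / 2 * ε + 3 * η) / κ by positivity)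
        (pNorm_ofReal_nonneg hα (0 : EuclideanSpace ℝ (Fin d)))
      simpa using this
    have ha := pNorm_ofReal_pos hα hu
    set a := pNorm (ENNReal.ofReal α) u
    have h1 := halfspaceDepth_le ν x hu
    have h2 := (abs_le.1 (hν u ⟪x, u⟫)).2
    rw [contaminated_real hε.le (by linarith), hP.real_halfspace_eq hα i hu] at h2
    have h3 := mul_le_mul_of_nonneg_left
      (measureReal_le_one (μ := Q) (s := {y | ⟪y, u⟫ ≤ ⟪x, u⟫})) hε.le
    have h4 := hx 0
    rw [← div_le_iff₀ ha]
    set s := -⟪x, u⟫ / a with hs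
    have hsx : ⟪x, u⟫ / a = -s := by rw [hs]; ring
    rw [hsx] at h2
    rcases le_or_gt s 0 with hs0 | hs0
    · exact hs0.trans (by positivity)
    have h5 : (1 - ε) * (marginalCDF P i 0 - marginalCDF P i (-s)) ≤ ε + 2 * η := by linarith
    have hdrop : ∀ t, 0 < t → t < γ → t ≤ s → κ * t ≤ ε / (1 - ε) + 3 * η ∧
        κ * t ≤ 3 / 2 * ε + 3 * η := by
      intro t ht htγ hts
      have h6 := hG.marginalCDF_neg_le ht htγ
      have h7 := marginalCDF_mono (P := P) i (neg_le_neg hts)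
      have h8 : (1 - ε) * (κ * t) ≤ ε + 2 * η :=
        (mul_le_mul_of_nonneg_left (by linarith) hε1.le).trans h5
      have h9 : κ * t ≤ (ε + 2 * η) / (1 - ε) := by rw [le_div_iff₀ hε1]; linarith
      have h10 : 2 * η / (1 - ε) ≤ 3 * η := by rw [div_le_iff₀ hε1]; nlinarith
      have h11 : ε / (1 - ε) ≤ 3 / 2 * ε := by rw [div_le_iff₀ hε1]; nlinarith
      rw [add_div] at h9
      exact ⟨by linarith, by linarith⟩
    have hsγ : s < γ := by
      by_contra! hcon
      -- Letting `t` tend to `γ` contradicts the smallness of `η`.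
      have h6 : ∀ᶠ t in nhdsWithin γ (Set.Iio γ), κ * t ≤ ε / (1 - ε) + 3 * η := by
        filter_upwards [Ioo_mem_nhdsLT hγ] with t ht
        exact (hdrop t ht.1 ht.2 (ht.2.le.trans hcon)).1
      have h7 : Filter.Tendsto (fun t => κ * t) (nhdsWithin γ (Set.Iio γ)) (nhds (κ * γ)) :=
        (continuous_const.mul continuous_id).continuousWithinAt
      have := le_of_tendsto h7 h6
      linarith
    rw [le_div_iff₀ hκ, mul_comm]
    exact (hdrop s hs0 hsγ le_rfl).2
  rw [abs_le]
  have h1 := key u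
  have h2 := key (-u)
  have h3 : pNorm (ENNReal.ofReal α) (-u) = pNorm (ENNReal.ofReal α) u := by
    rw [← neg_one_smul ℝ u, pNorm_ofReal_smul hα]; simp
  rw [h3, inner_neg_right, neg_neg] at h2
  exact ⟨by linarith, h2⟩

end AlphaSymmetric

/-! ### Concentration of the halfspace median -/

/-- The constants `C₁, C₂` are universal and `C` depends on `κ` only. The last line says that the event
`‖median of the sample - median of P‖_β ≤ C (ε + √(d/n) + √(log(1/δ)/n))` has probability at least
`1 - 2δ`; it is written as an upper bound for the (outer) probability of the complementary event, so
that it has this meaning without any measurability claim about the sample median. -/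
theorem mainTheorem1 :
    ∃ C₁ C₂ : ℝ, 0 < C₁ ∧ 0 < C₂ ∧
      ∀ κ : ℝ, 0 < κ →
      ∃ C : ℝ, 0 < C ∧
        ∀ (α γ ε δ : ℝ), 0 < α → 0 < γ → 0 < ε → ε < 1 / 3 → 0 < δ → δ < 1 / 2 →
        ε / (1 - ε) < γ * κ → γ * κ ≤ 1 / 2 →
        ∀ (d n : ℕ) (hd : 2 ≤ d), 0 < n →
        C₁ * √(d / n) + C₂ * √(Real.log (1 / δ) / n) < γ * κ - ε / (1 - ε) →
        ∀ (P Q : Measure (EuclideanSpace ℝ (Fin d)))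
          [IsProbabilityMeasure P] [IsProbabilityMeasure Q],
        IsAlphaSymmetric α P → P {0} = 0 →
        GrowthCondition γ κ (marginalCDF P ⟨0, by omega⟩) →
        ∀ {Ω : Type*} [MeasurableSpace Ω] (Pr : Measure Ω) [IsProbabilityMeasure Pr]
          (X : Fin n → Ω → EuclideanSpace ℝ (Fin d)),
        iIndepFun X Pr → (∀ i, HasLaw (X i) (contaminated ε P Q) Pr) →
        Pr.real {ω | ¬ pNorm (conjIndex α)
            (halfspaceMedian (empiricalLaw fun i => X i ω) - halfspaceMedian P) ≤
              C * (ε + √(d / n) + √(Real.log (1 / δ) / n))} ≤ 2 * δ := by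
  -- With `η = 160 √(d / n) + 64 √(log (1 / δ) / n)`, the constants `480` and `192` are those of `3 η`,
  -- as needed both for the smallness condition and for the radius `(3 ε / 2 + 3 η) / κ`.
  refine ⟨480, 192, by norm_num, by norm_num, fun κ hκ => ⟨480 / κ, by positivity, ?_⟩⟩
  intro α γ ε δ hα hγ hε hε3 hδ hδ2 _ _ d n hd hn hsmall P Q _ _ hP _ hG Ω _ Pr _ X hindep hX
  have hM : IsProbabilityMeasure (contaminated ε P Q) :=
    isProbabilityMeasure_contaminated hε.le (by linarith)
  obtain ⟨B, hB, hBμ, hdev⟩ :=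
    exists_measurableSet_halfspace_deviation (by omega) hn (contaminated ε P Q) hδ hδ2
  have hlaw := hindep.hasLaw_pi hX
  have hPB : Pr.real {ω | (fun i => X i ω) ∈ B} ≤ 2 * δ := by
    have h1 : Pr {ω | (fun i => X i ω) ∈ B} ≤ ENNReal.ofReal (2 * δ) := by
      rw [hlaw.measure_eq (p := fun x => x ∈ B) hB]; exact hBμ
    exact ENNReal.toReal_le_of_le_ofReal (by linarith) h1
  refine (measureReal_mono fun ω hω => ?_).trans hPB
  by_contra hωB
  apply hω
  set a := √((d : ℝ) / n)
  set b := √(Real.log (1 / δ) / n)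
  have ha : 0 ≤ a := Real.sqrt_nonneg _
  have hb : 0 ≤ b := Real.sqrt_nonneg _
  have hR : 0 ≤ (3 / 2 * ε + 3 * (160 * a + 64 * b)) / κ := by positivity
  rw [hP.halfspaceMedian_eq_zero hα hγ hκ _ hG, sub_zero]
  have h1 := abs_inner_barycenter_le hα hR fun x hx u =>
    hP.abs_inner_medianSet_le hα hγ hκ _ hG hε hε3 (by positivity) (by linarith) (hdev _ hωB) hx u
  refine (pNorm_conjIndex_le hα hR h1).trans ?_
  calc (3 / 2 * ε + 3 * (160 * a + 64 * b)) / κ ≤ 480 * (ε + a + b) / κ := by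
        gcongr; linarith
    _ = 480 / κ * (ε + a + b) := by ring
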